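/- Conventions. For a group $G$ and a conjugacy class $c$ of $G$, let $N^{cy}(G)$ be the cyclic bar construction: the cyclic set with $N^{cy}(G)_p=G^{p+1}$, faces $\partial_i(g_0,\dots,g_p)=(g_0,\dots,g_ig_{i+1},\dots,g_p)$ for $i<p$ and $\partial_p(g_0,\dots,g_p)=(g_pg_0,g_1,\dots,g_{p-1})$, degeneracies $s_j$ inserting $1$ after $g_j$, and cyclic operators $t_p(g_0,\dots,g_p)=(g_p,g_0,\dots,g_{p-1})$. Let $N^{cy}(G)_c\subset N^{cy}(G)$ be the cyclic subset of all tuples with $g_0g_1\cdots g_p\in c$, so that $N^{cy}(G)=\coprod_c N^{cy}(G)_c$. For a group $C$ and a central element $z\in C$, let $B(C,z)$ be the nerve $BC$ with the cyclic operators $t_p[a_1,\dots,a_p]=[z(a_1\cdots a_p)^{-1},a_1,\dots,a_{p-1}]$. For $c\neq\langle 1\rangle$ let $C_c$ be the group of families $(a_y)_{y\in c}$ with $a_y$ in the centralizer $C_y$ of $y$ and $a_{h^{-1}yh}=h^{-1}a_yh$ for all $y\in c$, $h\in G$; let $C_{\langle1\rangle}=G$. The family $(y)_{y\in c}$ (the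 element $1$ if $c=\langle 1\rangle$) is a central element of $C_c$, and $BC_c$ denotes $B(C_c,(y)_{y\in c})$. If $G$ and $H$ are free groups, a homomorphism $f:G\to H$ induces a unique homomorphism $C_c\to C_{f(c)}$ whose components are the restrictions $C_y\to C_{f(y)}$ of $f$; in this way $G\mapsto\coprod_cBC_c$ is a functor $f\mapsto f_*$ from free groups to cyclic sets, as is $G\mapsto N^{cy}(G)$. A map $X\to Y$ of simplicial sets is a weak equivalence if it induces a bijection $[Y,K]\to[X,K]$ of homotopy classes for every Kan complex $K$. Statement. Let $\Gamma_\bullet$ be a simplicial group with every $\Gamma_n$ free, so that $[n]\mapsto\coprod_{c}BC_{c}$ and $[n]\mapsto N^{cy}(\Gamma_n)$ (with $c$ running through the conjugacy classes of $\Gamma_n$) are simplicial objects in cyclic sets. (1) For every $n$, every conjugacy class $c$ of $\Gamma_n$ and every $y\in c$, the evaluation $a\mapsto a_y$ is an isomorphism of $C_c$ onto the centralizer $C_y$. If $c\ne\langle1\rangle$, there is a unique $r\in C_c$ such that, for every $y\in c$, the element $r_y$ generates $C_y$ and $y$ is a positive power of $r_y$. (2) Choose for every $n$ and every conjugacy class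 $c$ of $\Gamma_n$ an element $b_c\in c$. For each $n$, the formula $[a_1,\dots,a_p]\mapsto((\bar a_1\cdots \bar a_p)^{-1}b_c,\bar a_1,\dots,\bar a_p)$, where $\bar a_i=(a_i)_{b_c}$, defines injective maps of cyclic sets $BC_c\hookrightarrow N^{cy}(\Gamma_n)_c$ and hence an injective map of cyclic sets $$F_n:\coprod_{c}BC_{c}\longrightarrow\coprod_{c}N^{cy}(\Gamma_n)_{c}=N^{cy}(\Gamma_n).$$ Each map $BC_c\to N^{cy}(\Gamma_n)_c$, and each $F_n$, is a weak equivalence. (3) For every simplicial operator $\lambda:\Gamma_n\to\Gamma_m$, the maps $\lambda_*\circ F_n$ and $F_m\circ\lambda_*$ from $\coprod_cBC_c$ to $N^{cy}(\Gamma_m)$ are homotopic by a canonical homotopy. Precisely, there are families $(h_c)$ of elements of $\Gamma_m$, indexed by the conjugacy classes of $\Gamma_n$, with $h_c^{-1}\lambda(b_c)h_c=b_{\lambda(c)}$ and $h_{\langle 1\rangle}=1$, and for each such family there is a homotopy from $\lambda_*\circ F_n$ to $F_m\circ\lambda_*$ which on the summand $BC_c$ is $\lambda_*\circ F_n$ followed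 by the standard homotopy from the identity of $N^{cy}(\Gamma_m)$ to conjugation $(g_i)\mapsto(h_c^{-1}g_ih_c)$. For $h\in\Gamma_m$, this standard homotopy sends a $p$-simplex $((g_0,\dots,g_p),s)$ of $N^{cy}(\Gamma_m)\times\Delta[1]$, $s:[p]\to[1]$, to the tuple $(k_{i-1}^{-1}g_ik_i)_{0\le i\le p}$, where $k_i=1$ if $s(i)=0$, $k_i=h$ if $s(i)=1$, and $k_{-1}=k_p$. (4) The maps $F_n$ are natural in the same sense: for every morphism $f:\Gamma_\bullet\to\Gamma'_\bullet$ of degreewise free simplicial groups, all choices of elements in the conjugacy classes of the $\Gamma_n$ and of the $\Gamma'_n$, and every $n$, the assertion of (3) holds for $f_n:\Gamma_n\to\Gamma'_n$, with $F_n$ for $\Gamma_\bullet$ and $F_n$ for $\Gamma'_\bullet$, in place of $\lambda$, $F_n$ and $F_m$. (For $f=\mathrm{id}$: up to canonical homotopy, $F_n$ does not depend on the choices.) -/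

import Mathlib

universe u
open CategoryTheory Opposite Simplicial MonoidalCategory

namespace FreeGroupFacts

lemma subsingleton_of_central {X : Type u} (w : FreeGroup X) (hw : w ≠ 1)
    (hc : ∀ s : X, FreeGroup.of s * w = w * FreeGroup.of s) : ∃ x : X, ∀ s : X, s = x := by
  classical
  rcases hL : w.toWord with _ | ⟨⟨x, e⟩, L⟩
  · exact absurd (FreeGroup.toWord_eq_nil_iff.mp hL) hw
  refine ⟨x, fun s => ?_⟩
  by_contra hne
  have h1 : (FreeGroup.of s * w).toWord = (s, true) :: w.toWord := by
    rw [FreeGroup.toWord_mul, FreeGroup.toWord_of, List.singleton_append,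
      FreeGroup.reduce.cons, FreeGroup.reduce_toWord, hL]
    simp [hne]
  have h2 : (w * FreeGroup.of s).toWord.Sublist (w.toWord ++ [(s, true)]) := by
    simpa using FreeGroup.toWord_mul_sublist w (FreeGroup.of s)
  rw [← hc, h1] at h2
  have h3 := h2.eq_of_length (by simp)
  rw [hL] at h3
  simp only [List.cons_append, List.cons.injEq, Prod.mk.injEq] at h3
  exact hne h3.1.1

/-- In a free group the centralizer of a nontrivial element is cyclic. -/
lemma exists_generator_centralizer {G : Type u} [Group G] [IsFreeGroup G] {y : G} (hy : y ≠ 1) :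
    ∃ r : G, ∀ a : G, a * y = y * a → ∃ k : ℤ, a = r ^ k := by
  let K : Subgroup G := Subgroup.centralizer {y}
  let e : K ≃* FreeGroup (IsFreeGroup.Generators K) := IsFreeGroup.toFreeGroup K
  have hyK : y ∈ K := by simp [K, Subgroup.mem_centralizer_iff]
  have hne : e ⟨y, hyK⟩ ≠ 1 := by
    intro h
    have := (map_eq_one_iff e e.injective).mp h
    exact hy (congrArg Subtype.val this)
  obtain ⟨x, hx⟩ := subsingleton_of_central (e ⟨y, hyK⟩) hne (by
    intro s
    obtain ⟨k, hk⟩ := e.surjective (FreeGroup.of s)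
    rw [← hk, ← map_mul, ← map_mul]
    congr 1
    apply Subtype.ext
    have := Subgroup.mem_centralizer_iff.mp k.2 y rfl
    simpa using this.symm)
  have hz : ∀ w : FreeGroup (IsFreeGroup.Generators K), ∃ k : ℤ, w = FreeGroup.of x ^ k := by
    intro w
    have hw : w ∈ Subgroup.zpowers (FreeGroup.of x) := by
      have htop : w ∈ Subgroup.closure (Set.range (FreeGroup.of (α := IsFreeGroup.Generators K))) := by
        rw [FreeGroup.closure_range_of]; trivial
      refine (Subgroup.closure_le _).mpr ?_ htop
      rintro _ ⟨s, rfl⟩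
      rw [hx s]
      exact Subgroup.mem_zpowers _
    obtain ⟨k, hk⟩ := Subgroup.mem_zpowers_iff.mp hw
    exact ⟨k, hk.symm⟩
  refine ⟨(e.symm (FreeGroup.of x) : K), fun a ha => ?_⟩
  have haK : a ∈ K := by
    simp only [K, Subgroup.mem_centralizer_iff, Set.mem_singleton_iff, forall_eq]
    exact ha.symm
  obtain ⟨k, hk⟩ := hz (e ⟨a, haK⟩)
  refine ⟨k, ?_⟩
  have : (⟨a, haK⟩ : K) = e.symm (FreeGroup.of x) ^ k := by
    rw [← map_zpow, ← hk, e.symm_apply_apply]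
  simpa using congrArg Subtype.val this

lemma commute_of_commute {G : Type u} [Group G] [IsFreeGroup G] {y : G} (hy : y ≠ 1) {a b : G}
    (ha : a * y = y * a) (hb : b * y = y * b) : a * b = b * a := by
  obtain ⟨r, hr⟩ := exists_generator_centralizer hy
  obtain ⟨k, rfl⟩ := hr a ha
  obtain ⟨l, rfl⟩ := hr b hb
  rw [← zpow_add, ← zpow_add, add_comm]

lemma map_eq_one {G H : Type u} [Group G] [Group H] [IsFreeGroup G] [IsFreeGroup H] (f : G →* H)
    {y a : G} (hy : y ≠ 1) (ha : a * y = y * a) (hf : f y = 1) : f a = 1 := by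
  have : IsMulTorsionFree H :=
    Function.Injective.isMulTorsionFree (IsFreeGroup.toFreeGroup H).toMonoidHom
      (IsFreeGroup.toFreeGroup H).injective
  obtain ⟨r, hr⟩ := exists_generator_centralizer hy
  obtain ⟨k, hk⟩ := hr y rfl
  obtain ⟨l, rfl⟩ := hr a ha
  have hk0 : k ≠ 0 := by
    rintro rfl
    exact hy (by simpa using hk)
  have : f r ^ k = 1 := by rw [← map_zpow, ← hk, hf]
  have hr1 : f r = 1 := by
    exact zpow_left_injective hk0 (by simpa using this)
  rw [map_zpow, hr1, one_zpow]

end FreeGroupFacts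
/-- A cyclic set: a simplicial set with operators `t n` on its `n`-simplices satisfying the
relations of Connes' cyclic category. -/
structure CyclicSet where
  toSSet : SSet.{u}
  t (n : ℕ) : toSSet _⦋n⦌ → toSSet _⦋n⦌
  t_iterate (n : ℕ) (x : toSSet _⦋n⦌) : (t n)^[n + 1] x = x
  δ_zero_t (n : ℕ) (x : toSSet _⦋n + 1⦌) :
    toSSet.δ 0 (t (n + 1) x) = toSSet.δ (Fin.last (n + 1)) x
  δ_succ_t (n : ℕ) (i : Fin (n + 1)) (x : toSSet _⦋n + 1⦌) :
    toSSet.δ i.succ (t (n + 1) x) = t n (toSSet.δ i.castSucc x)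
  σ_zero_t (n : ℕ) (x : toSSet _⦋n⦌) :
    toSSet.σ 0 (t n x) = t (n + 1) (t (n + 1) (toSSet.σ (Fin.last n) x))
  σ_succ_t (n : ℕ) (i : Fin n) (x : toSSet _⦋n⦌) :
    toSSet.σ i.succ (t n x) = t (n + 1) (toSSet.σ i.castSucc x)

namespace CyclicSet

/-- A map of cyclic sets: a simplicial map commuting with the cyclic operators. -/
@[ext]
structure Hom (X Y : CyclicSet.{u}) where
  toSSetHom : X.toSSet ⟶ Y.toSSet
  comm (n : ℕ) (x : X.toSSet _⦋n⦌) :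
    toSSetHom.app (op ⦋n⦌) (X.t n x) = Y.t n (toSSetHom.app (op ⦋n⦌) x)

instance : Category CyclicSet.{u} where
  Hom X Y := Hom X Y
  id X := { toSSetHom := 𝟙 _, comm := fun _ _ => rfl }
  comp f g :=
    { toSSetHom := f.toSSetHom ≫ g.toSSetHom
      comm := fun n x => by
        simp only [SSet.comp_app, comp_apply, f.comm, g.comm] }

@[ext]
lemma hom_ext {X Y : CyclicSet.{u}} {f g : X ⟶ Y} (h : f.toSSetHom = g.toSSetHom) : f = g :=
  Hom.ext h

/-- The disjoint union of a family of cyclic sets. -/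
def sigma {ι : Type u} (X : ι → CyclicSet.{u}) : CyclicSet.{u} where
  toSSet :=
    { obj := fun n => Σ i, (X i).toSSet.obj n
      map := fun α => ↾fun x => ⟨x.1, (X x.1).toSSet.map α x.2⟩
      map_id := fun n => by
        refine ConcreteCategory.hom_ext _ _ fun x => ?_
        exact congrArg (Sigma.mk x.1) (ConcreteCategory.congr_hom ((X x.1).toSSet.map_id n) x.2)
      map_comp := fun α β => by
        refine ConcreteCategory.hom_ext _ _ fun x => ?_
        exact congrArg (Sigma.mk x.1)
          (ConcreteCategory.congr_hom ((X x.1).toSSet.map_comp α β) x.2) }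
  t n x := ⟨x.1, (X x.1).t n x.2⟩
  t_iterate n x := by
    obtain ⟨i, x⟩ := x
    have h : ∀ k : ℕ, (fun x : Σ i, (X i).toSSet _⦋n⦌ => (⟨x.1, (X x.1).t n x.2⟩ :
        Σ i, (X i).toSSet _⦋n⦌))^[k] ⟨i, x⟩ = ⟨i, ((X i).t n)^[k] x⟩ := by
      intro k
      induction k with
      | zero => rfl
      | succ k ih => rw [Function.iterate_succ_apply', ih, Function.iterate_succ_apply']
    exact (h (n + 1)).trans (by rw [(X i).t_iterate])
  δ_zero_t n x := congrArg (Sigma.mk x.1) ((X x.1).δ_zero_t n x.2)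
  δ_succ_t n i x := congrArg (Sigma.mk x.1) ((X x.1).δ_succ_t n i x.2)
  σ_zero_t n x := congrArg (Sigma.mk x.1) ((X x.1).σ_zero_t n x.2)
  σ_succ_t n i x := congrArg (Sigma.mk x.1) ((X x.1).σ_succ_t n i x.2)

/-- The map of disjoint unions given by a map `f` of index sets and maps of summands. -/
def sigmaMap {ι κ : Type u} {X : ι → CyclicSet.{u}} {Y : κ → CyclicSet.{u}} (f : ι → κ)
    (g : ∀ i, X i ⟶ Y (f i)) : sigma X ⟶ sigma Y where
  toSSetHom :=
    { app := fun n => ↾fun x => ⟨f x.1, (g x.1).toSSetHom.app n x.2⟩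
      naturality := fun m n α => by
        ext x
        exact congrArg (Sigma.mk (f x.1))
          (ConcreteCategory.congr_hom ((g x.1).toSSetHom.naturality α) x.2) }
  comm n x := congrArg (Sigma.mk (f x.1)) ((g x.1).comm n x.2)

/-- The map out of a disjoint union given by maps on the summands. -/
def sigmaDesc {ι : Type u} {X : ι → CyclicSet.{u}} {Y : CyclicSet.{u}}
    (g : ∀ i, X i ⟶ Y) : sigma X ⟶ Y where
  toSSetHom :=
    { app := fun n => ↾fun x => (g x.1).toSSetHom.app n x.2
      naturality := fun m n α => by
        ext x
        exact ConcreteCategory.congr_hom ((g x.1).toSSetHom.naturality α) x.2 }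
  comm n x := (g x.1).comm n x.2

/-- The cyclic structure on a simplicial set induced by an embedding into a cyclic set whose
image is stable under the cyclic operators. -/
def ofEmbedding (Y : CyclicSet.{u}) (X : SSet.{u}) (f : X ⟶ Y.toSSet)
    (hf : ∀ n : ℕ, Function.Injective (f.app (op ⦋n⦌)))
    (t : ∀ n : ℕ, X _⦋n⦌ → X _⦋n⦌)
    (ht : ∀ (n : ℕ) (x : X _⦋n⦌), f.app (op ⦋n⦌) (t n x) = Y.t n (f.app (op ⦋n⦌) x)) :
    CyclicSet.{u} where
  toSSet := X
  t := t
  t_iterate n x := by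
    have h : Function.Semiconj (f.app (op ⦋n⦌)) (t n) (Y.t n) := ht n
    exact hf n ((h.iterate_right (n + 1) x).trans (Y.t_iterate n _))
  δ_zero_t n x := hf n (by
    rw [SSet.δ_naturality_apply, SSet.δ_naturality_apply, ht, Y.δ_zero_t])
  δ_succ_t n i x := hf n (by
    rw [ht, SSet.δ_naturality_apply, SSet.δ_naturality_apply, ht, Y.δ_succ_t])
  σ_zero_t n x := hf (n + 1) (by
    rw [ht, ht, SSet.σ_naturality_apply, SSet.σ_naturality_apply, ht, Y.σ_zero_t])
  σ_succ_t n i x := hf (n + 1) (by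
    rw [ht, SSet.σ_naturality_apply, SSet.σ_naturality_apply, ht, Y.σ_succ_t])

end CyclicSet

section WeakEquivalence

/-- The set `[X, K]` of simplicial homotopy classes of maps. -/
def HomotopyClasses (X K : SSet.{u}) : Type u :=
  Quot fun f g : X ⟶ K => Nonempty (SSet.Homotopy f g)

/-- The map `[Y, K] → [X, K]` induced by `f : X ⟶ Y`. -/
def HomotopyClasses.precomp {X Y : SSet.{u}} (f : X ⟶ Y) (K : SSet.{u}) :
    HomotopyClasses Y K → HomotopyClasses X K :=
  Quot.map (fun g => f ≫ g) (by
    rintro g g' ⟨h⟩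
    exact ⟨{ h := f ▷ _ ≫ h.h
             h₀ := by
              show SSet.ι₀ ≫ f ▷ _ ≫ h.h = f ≫ g
              rw [SSet.ι₀_comp_assoc, h.h₀]
             h₁ := by
              show SSet.ι₁ ≫ f ▷ _ ≫ h.h = f ≫ g'
              rw [SSet.ι₁_comp_assoc, h.h₁]
             rel := by ext _ ⟨⟨_, ⟨⟩⟩, _⟩ }⟩)

/-- A map `f : X ⟶ Y` of simplicial sets is a weak (homotopy) equivalence if for every Kan complex
`K` it induces a bijection `[Y, K] → [X, K]`. -/
def IsWeakEquivalence {X Y : SSet.{u}} (f : X ⟶ Y) : Prop :=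
  ∀ K : SSet.{u}, SSet.KanComplex K → Function.Bijective (HomotopyClasses.precomp f K)

end WeakEquivalence
namespace CyclicNerve

/-- The cyclic operator `(g₀, …, g_p) ↦ (g_p, g₀, …, g_{p-1})`. -/
def rot {G : Type u} {p : ℕ} (g : Fin (p + 1) → G) : Fin (p + 1) → G := fun i => g (i - 1)

lemma rot_succ {G : Type u} {p : ℕ} (g : Fin (p + 1) → G) (k : Fin p) : rot g k.succ = g k.castSucc := by
  rw [rot, ← Fin.coeSucc_eq_succ, add_sub_cancel_right]

lemma rot_zero {G : Type u} {p : ℕ} (g : Fin (p + 1) → G) : rot g 0 = g (Fin.last p) := by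
  rw [rot]
  congr 1
  rw [sub_eq_iff_eq_add]
  simp

lemma rot_iterate {G : Type u} {p : ℕ} (g : Fin (p + 1) → G) : rot^[p + 1] g = g := by
  have h : ∀ k : ℕ, rot^[k] g = fun i => g (i - k • 1) := by
    intro k
    induction k with
    | zero => simp
    | succ k ih =>
      rw [Function.iterate_succ_apply', ih]
      ext i
      simp only [rot, succ_nsmul']
      congr 1
      abel
  have h1 : (p + 1) • (1 : Fin (p + 1)) = 0 := by
    simpa using card_nsmul_eq_zero (G := Fin (p + 1)) (x := 1)
  rw [h, h1]
  simp

variable {G H : Type u} [Group G] [Group H] {p q r : ℕ}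

/-- For a tuple `(g₀, …, g_p)`, the products `g₁ ⋯ g_j`, `0 ≤ j ≤ p`. -/
def base (g : Fin (p + 1) → G) : Fin (p + 1) → G := Fin.partialProd (Fin.tail g)

/-- For a tuple `(g₀, …, g_p)`, the product `g₁ ⋯ g_p g₀`. -/
def loop (g : Fin (p + 1) → G) : G := base g (Fin.last p) * g 0

/-- The action of a simplicial operator `α : [q] → [p]` on the nerve of a group:
`(a₁, …, a_p)` is sent to the tuple whose `i`-th entry is the product of the `a_j` with
`α (i - 1) < j ≤ α i`. -/
def barOp (α : Fin (q + 1) → Fin (p + 1)) (a : Fin p → G) : Fin q → G :=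
  fun i => (Fin.partialProd a (α i.castSucc))⁻¹ * Fin.partialProd a (α i.succ)

/-- The action of a simplicial operator `α : [q] → [p]` on the cyclic nerve: for `i ≥ 1` the
`i`-th entry is the product of the `g_j` with `α (i - 1) < j ≤ α i`, and the zeroth entry is
`(g_{α q + 1} ⋯ g_p) g₀ (g₁ ⋯ g_{α 0})`. -/
def cycOp (α : Fin (q + 1) → Fin (p + 1)) (g : Fin (p + 1) → G) : Fin (q + 1) → G :=
  Fin.cons ((base g (α (Fin.last q)))⁻¹ * base g (Fin.last p) * g 0 * base g (α 0))
    (barOp α (Fin.tail g))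

lemma partialProd_injective {a b : Fin p → G} (h : Fin.partialProd a = Fin.partialProd b) :
    a = b := by
  ext i
  rw [← Fin.partialProd_right_inv a, ← Fin.partialProd_right_inv b, h]

lemma partialProd_barOp (α : Fin (q + 1) → Fin (p + 1)) (a : Fin p → G) (j : Fin (q + 1)) :
    Fin.partialProd (barOp α a) j =
      (Fin.partialProd a (α 0))⁻¹ * Fin.partialProd a (α j) := by
  induction j using Fin.induction with
  | zero => simp
  | succ i ih => rw [Fin.partialProd_succ, ih, barOp]; group

lemma base_zero (g : Fin (p + 1) → G) : base g 0 = 1 := Fin.partialProd_zero _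

lemma base_cycOp (α : Fin (q + 1) → Fin (p + 1)) (g : Fin (p + 1) → G) (j : Fin (q + 1)) :
    base (cycOp α g) j = (base g (α 0))⁻¹ * base g (α j) := by
  simp only [base, cycOp, Fin.tail_cons, partialProd_barOp]

lemma loop_cycOp (α : Fin (q + 1) → Fin (p + 1)) (g : Fin (p + 1) → G) :
    loop (cycOp α g) = (base g (α 0))⁻¹ * loop g * base g (α 0) := by
  rw [loop, base_cycOp, loop, cycOp, Fin.cons_zero]
  group

lemma ext_base_loop {g g' : Fin (p + 1) → G} (h₁ : base g = base g') (h₂ : loop g = loop g') :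
    g = g' := by
  have h0 : g 0 = g' 0 := by
    rw [loop, loop, h₁] at h₂
    exact mul_left_cancel h₂
  have ht : Fin.tail g = Fin.tail g' := partialProd_injective h₁
  rw [← Fin.cons_self_tail g, ← Fin.cons_self_tail g', h0, ht]

lemma base_rot_succ (g : Fin (p + 1) → G) (k : Fin p) :
    base (rot g) k.succ = (base g (Fin.last p))⁻¹ * loop g * base g k.castSucc := by
  have h : Fin.tail (rot g) = Fin.init g := by
    ext i
    exact rot_succ g i
  rw [loop, inv_mul_cancel_left, base, h, Fin.partialProd_init, ← Fin.succ_castSucc,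
    Fin.partialProd_succ', base]

lemma loop_rot (g : Fin (p + 1) → G) :
    loop (rot g) = (base g (Fin.last p))⁻¹ * loop g * base g (Fin.last p) := by
  rw [loop, rot_zero]
  cases p with
  | zero =>
    have : (Fin.last 0) = 0 := rfl
    simp [loop, this, base_zero]
  | succ p =>
    rw [← Fin.succ_last, base_rot_succ, mul_assoc, ← Fin.succ_last]
    congr 1
    exact (Fin.partialProd_succ (Fin.tail g) (Fin.last p)).symm

lemma cycOp_id (g : Fin (p + 1) → G) : cycOp id g = g :=
  ext_base_loop (by ext j; simp [base_cycOp, base_zero]) (by simp [loop_cycOp, base_zero])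

lemma cycOp_comp (α : Fin (q + 1) → Fin (p + 1)) (β : Fin (r + 1) → Fin (q + 1))
    (g : Fin (p + 1) → G) : cycOp (α ∘ β) g = cycOp β (cycOp α g) :=
  ext_base_loop (by ext j; simp [base_cycOp]) (by simp [loop_cycOp, base_cycOp, mul_assoc])

lemma barOp_id (a : Fin p → G) : barOp id a = a :=
  partialProd_injective (by ext j; simp [partialProd_barOp])

lemma barOp_comp (α : Fin (q + 1) → Fin (p + 1)) (β : Fin (r + 1) → Fin (q + 1))
    (a : Fin p → G) : barOp (α ∘ β) a = barOp β (barOp α a) :=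
  partialProd_injective (by ext j; simp [partialProd_barOp])

lemma partialProd_comp (φ : G →* H) (a : Fin p → G) (j : Fin (p + 1)) :
    Fin.partialProd (φ ∘ a) j = φ (Fin.partialProd a j) := by
  induction j using Fin.induction with
  | zero => simp
  | succ i ih => rw [Fin.partialProd_succ, Fin.partialProd_succ, ih, map_mul]; rfl

lemma base_comp (φ : G →* H) (g : Fin (p + 1) → G) (j : Fin (p + 1)) :
    base (φ ∘ g) j = φ (base g j) := partialProd_comp φ (Fin.tail g) j

lemma loop_comp (φ : G →* H) (g : Fin (p + 1) → G) : loop (φ ∘ g) = φ (loop g) := by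
  rw [loop, loop, base_comp, map_mul]; rfl

lemma barOp_map (φ : G →* H) (α : Fin (q + 1) → Fin (p + 1)) (a : Fin p → G) :
    barOp α (φ ∘ a) = φ ∘ barOp α a :=
  partialProd_injective (by ext j; simp [partialProd_barOp, partialProd_comp])

lemma cycOp_map (φ : G →* H) (α : Fin (q + 1) → Fin (p + 1)) (g : Fin (p + 1) → G) :
    cycOp α (φ ∘ g) = φ ∘ cycOp α g :=
  ext_base_loop (by ext j; simp [base_cycOp, base_comp])
    (by simp [loop_cycOp, base_comp, loop_comp])

lemma δ_zero_rot (g : Fin (p + 1 + 1) → G) :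
    cycOp (Fin.succAbove 0) (rot g) = cycOp (Fin.succAbove (Fin.last (p + 1))) g := by
  apply ext_base_loop
  · ext j
    rw [base_cycOp, base_cycOp]
    simp only [Fin.succAbove_zero, Fin.succAbove_last, base_rot_succ]
    group
  · rw [loop_cycOp, loop_cycOp, loop_rot]
    simp only [Fin.succAbove_zero, Fin.succAbove_last, base_rot_succ, Fin.castSucc_zero, base_zero]
    group

lemma δ_succ_rot (i : Fin (p + 1)) (g : Fin (p + 1 + 1) → G) :
    cycOp (Fin.succAbove i.succ) (rot g) = rot (cycOp (Fin.succAbove i.castSucc) g) := by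
  have hl : i.castSucc.succAbove (Fin.last p) = Fin.last (p + 1) :=
    Fin.succAbove_ne_last_last (Fin.castSucc_lt_last i).ne
  have h0 : i.succ.succAbove (0 : Fin (p + 1)) = 0 :=
    Fin.succAbove_ne_zero_zero (Fin.succ_ne_zero i)
  apply ext_base_loop
  · ext j
    rw [base_cycOp, h0, base_zero, inv_one, one_mul]
    cases j using Fin.cases with
    | zero => rw [h0, base_zero, base_zero]
    | succ k =>
      rw [base_rot_succ, Fin.succ_succAbove_succ, base_rot_succ, base_cycOp, base_cycOp,
        loop_cycOp, hl, Fin.castSucc_succAbove_castSucc]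
      group
  · rw [loop_cycOp, h0, base_zero, loop_rot, loop_rot, loop_cycOp, base_cycOp, hl]
    group

lemma σ_succ_rot (i : Fin p) (g : Fin (p + 1) → G) :
    cycOp (Fin.predAbove i.succ) (rot g) =
      rot (cycOp (Fin.predAbove (i.castSucc : Fin (p + 1))) g) := by
  have hl : (i.castSucc : Fin (p + 1)).predAbove (Fin.last (p + 1)) = Fin.last p := by
    exact Fin.predAbove_right_last
  have h0 : (i.succ : Fin (p + 1)).predAbove (0 : Fin (p + 2)) = 0 := Fin.predAbove_right_zero
  apply ext_base_loop
  · ext j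
    rw [base_cycOp, h0, base_zero, inv_one, one_mul]
    cases j using Fin.cases with
    | zero => rw [h0, base_zero, base_zero]
    | succ k =>
      cases p with
      | zero => exact i.elim0
      | succ p =>
      rw [base_rot_succ, Fin.succ_predAbove_succ, base_rot_succ, base_cycOp, base_cycOp,
        loop_cycOp, hl, Fin.castSucc_predAbove_castSucc]
      group
  · rw [loop_cycOp, h0, base_zero, loop_rot, loop_rot, loop_cycOp, base_cycOp, hl]
    group

lemma σ_zero_rot (g : Fin (p + 1) → G) :
    cycOp (Fin.predAbove (0 : Fin (p + 1))) (rot g) =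
      rot (rot (cycOp (Fin.predAbove (Fin.last p)) g)) := by
  have hl : (Fin.last p).predAbove (Fin.last (p + 1)) = Fin.last p := by
    simp
  have h0 : (0 : Fin (p + 1)).predAbove (0 : Fin (p + 2)) = 0 := Fin.predAbove_right_zero
  have h0' : (Fin.last p).predAbove (0 : Fin (p + 2)) = 0 := Fin.predAbove_right_zero
  have key : base (rot (cycOp (Fin.predAbove (Fin.last p)) g)) (Fin.last (p + 1)) =
      (base g (Fin.last p))⁻¹ * loop g * base g (Fin.last p) := by
    rw [← Fin.succ_last, base_rot_succ, base_cycOp, base_cycOp, loop_cycOp, hl, h0', base_zero,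
      Fin.predAbove_castSucc_self]
    group
  have key' : loop (rot (cycOp (Fin.predAbove (Fin.last p)) g)) =
      (base g (Fin.last p))⁻¹ * loop g * base g (Fin.last p) := by
    rw [loop_rot, loop_cycOp, base_cycOp, hl, h0', base_zero]
    group
  apply ext_base_loop
  · ext j
    rw [base_cycOp, h0, base_zero, inv_one, one_mul]
    cases j using Fin.cases with
    | zero => rw [h0, base_zero, base_zero]
    | succ k =>
      rw [base_rot_succ, key, key', inv_mul_cancel, one_mul, Fin.predAbove_zero_succ]
      cases k using Fin.cases with
      | zero => rw [base_zero, Fin.castSucc_zero, base_zero]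
      | succ m =>
        rw [← Fin.succ_castSucc, base_rot_succ, base_rot_succ, base_cycOp, base_cycOp,
          loop_cycOp, hl, h0', base_zero, Fin.predAbove_last_castSucc]
        group
  · rw [loop_cycOp, h0, base_zero, loop_rot, loop_rot, key, key']
    group

/-- The faces `∂ᵢ`, `i < p`, multiply two adjacent entries. -/
lemma cycOp_face (i : Fin (p + 1)) (g : Fin (p + 1 + 1) → G) :
    cycOp (Fin.succAbove i.castSucc) g = Fin.contractNth i.castSucc (· * ·) g := by
  ext k
  cases k using Fin.cases with
  | zero =>
    rw [cycOp, Fin.cons_zero, Fin.succAbove_ne_last_last (Fin.castSucc_lt_last i).ne,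
      inv_mul_cancel, one_mul]
    cases i using Fin.cases with
    | zero =>
      rw [Fin.contractNth_apply_of_eq _ _ _ _ (by simp)]
      have h : base g (Fin.succ 0) = g 1 := by
        rw [base, Fin.partialProd_succ, Fin.castSucc_zero, Fin.partialProd_zero, one_mul]
        rfl
      rw [Fin.castSucc_zero, Fin.succAbove_zero, h]
      rfl
    | succ i =>
      rw [Fin.contractNth_apply_of_lt _ _ _ _ (by simp), Fin.castSucc_zero,
        Fin.succAbove_ne_zero_zero (by simp), base_zero, mul_one]
  | succ k =>
    cases p with
    | zero => exact k.elim0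
    | succ p =>
    rw [cycOp, Fin.cons_succ, barOp]
    cases i using Fin.cases with
    | zero =>
      rw [Fin.contractNth_apply_of_gt _ _ _ _ (by simp)]
      simp only [Fin.castSucc_zero, Fin.succAbove_zero]
      exact Fin.partialProd_right_inv (Fin.tail g) k.succ
    | succ i =>
      rw [← Fin.succ_castSucc, Fin.succ_succAbove_succ]
      refine (Fin.inv_partialProd_mul_eq_contractNth (Fin.tail g) i.castSucc k).trans ?_
      simp [Fin.contractNth, Fin.tail]

/-- The last face sends `(g₀, …, g_p)` to `(g_p g₀, g₁, …, g_{p-1})`. -/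
lemma cycOp_last_face (g : Fin (p + 1 + 1) → G) :
    cycOp (Fin.succAbove (Fin.last (p + 1))) g =
      Fin.cons (g (Fin.last (p + 1)) * g 0) (fun j => g j.succ.castSucc) := by
  ext k
  cases k using Fin.cases with
  | zero =>
    rw [cycOp, Fin.cons_zero, Fin.cons_zero, Fin.succAbove_last, Fin.castSucc_zero, base_zero,
      mul_one, ← Fin.succ_last]
    congr 1
    exact Fin.partialProd_right_inv (Fin.tail g) (Fin.last p)
  | succ k =>
    rw [cycOp, Fin.cons_succ, Fin.cons_succ, barOp, Fin.succAbove_last]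
    exact Fin.partialProd_right_inv (Fin.tail g) k.castSucc

/-- The degeneracy `sⱼ` inserts `1` behind the entry `gⱼ`. -/
lemma cycOp_degeneracy (j : Fin (p + 1)) (g : Fin (p + 1) → G) :
    cycOp (Fin.predAbove j) g = Fin.insertNth j.succ (1 : G) g := by
  rw [Fin.eq_insertNth_iff]
  refine ⟨?_, ?_⟩
  · rw [cycOp, Fin.cons_succ, barOp, Fin.predAbove_castSucc_self, Fin.predAbove_succ_self,
      inv_mul_cancel]
  · ext k
    rw [Fin.removeNth_apply]
    cases k using Fin.cases with
    | zero =>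
      rw [Fin.succ_succAbove_zero, cycOp, Fin.cons_zero, Fin.predAbove_right_last,
        Fin.predAbove_right_zero, base_zero, inv_mul_cancel, one_mul, mul_one]
    | succ m =>
      cases p with
      | zero => exact m.elim0
      | succ p =>
      rw [Fin.succ_succAbove_succ, cycOp, Fin.cons_succ, barOp]
      have h1 : j.predAbove (j.succAbove m).castSucc = m.castSucc := by
        rcases lt_or_ge m.castSucc j with h | h
        · rw [Fin.succAbove_of_castSucc_lt _ _ h, Fin.predAbove_castSucc_of_le _ _ h.le]
        · rw [Fin.succAbove_of_le_castSucc _ _ h, Fin.predAbove_castSucc_of_lt _ _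
            (lt_of_le_of_lt h Fin.castSucc_lt_succ)]
          rfl
      have h2 : j.predAbove (j.succAbove m).succ = m.succ := by
        rcases lt_or_ge m.castSucc j with h | h
        · rw [Fin.succAbove_of_castSucc_lt _ _ h, Fin.predAbove_succ_of_lt _ _ h]
          rfl
        · rw [Fin.succAbove_of_le_castSucc _ _ h, Fin.predAbove_succ_of_le _ _
            (h.trans Fin.castSucc_lt_succ.le)]
      rw [h1, h2, Fin.partialProd_right_inv]
      rfl

end CyclicNerve

open CyclicNerve

/-- The cyclic bar construction `N^{cy}(G)`, with `N^{cy}(G)_p = G^{p+1}`. -/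
def cyclicNerve (G : Type u) [Group G] : CyclicSet.{u} where
  toSSet :=
    { obj := fun n => Fin (n.unop.len + 1) → G
      map := fun α => ↾fun g => cycOp α.unop.toOrderHom g
      map_id := fun _ => ConcreteCategory.hom_ext _ _ fun g => cycOp_id g
      map_comp := fun α β => ConcreteCategory.hom_ext _ _ fun g =>
        cycOp_comp α.unop.toOrderHom β.unop.toOrderHom g }
  t _ g := rot g
  t_iterate _ g := rot_iterate g
  δ_zero_t _ g := δ_zero_rot g
  δ_succ_t _ i g := δ_succ_rot i g
  σ_zero_t _ g := σ_zero_rot g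
  σ_succ_t _ i g := σ_succ_rot i g

/-- The map `N^{cy}(G) ⟶ N^{cy}(H)` induced by a homomorphism. -/
def cyclicNerveMap {G H : Type u} [Group G] [Group H] (φ : G →* H) :
    cyclicNerve G ⟶ cyclicNerve H where
  toSSetHom :=
    { app := fun n => ↾fun g => φ ∘ (g : Fin (n.unop.len + 1) → G)
      naturality := fun _ _ α => ConcreteCategory.hom_ext _ _ fun g =>
        (cycOp_map φ α.unop.toOrderHom g).symm }
  comm _ _ := rfl

/-- The nerve `BC` of a group, with `BC_p = C^p`. -/
def bar (C : Type u) [Group C] : SSet.{u} where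
  obj := fun n => Fin n.unop.len → C
  map := fun α => ↾fun a => barOp α.unop.toOrderHom a
  map_id := fun _ => ConcreteCategory.hom_ext _ _ fun a => barOp_id a
  map_comp := fun α β => ConcreteCategory.hom_ext _ _ fun a =>
    barOp_comp α.unop.toOrderHom β.unop.toOrderHom a

namespace CyclicNerve

/-- For a homomorphism `φ : C →* G` and `y : G`, the tuple
`((φ a₁ ⋯ φ a_p)⁻¹ y, φ a₁, …, φ a_p)`. -/
def tuple {C G : Type u} [Group C] [Group G] (φ : C →* G) (y : G) {p : ℕ} (a : Fin p → C) :
    Fin (p + 1) → G :=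
  Fin.cons ((Fin.partialProd (φ ∘ a) (Fin.last p))⁻¹ * y) (φ ∘ a)

/-- The operator `[a₁, …, a_p] ↦ [z (a₁ ⋯ a_p)⁻¹, a₁, …, a_{p-1}]`. -/
def barRot {C : Type u} [Group C] (z : C) {p : ℕ} (a : Fin p → C) : Fin p → C := fun i =>
  if (i : ℕ) = 0 then z * (Fin.partialProd a (Fin.last p))⁻¹
  else a ⟨(i : ℕ) - 1, lt_of_le_of_lt (Nat.sub_le _ _) i.isLt⟩

variable {C G : Type u} [Group C] [Group G] (φ : C →* G) (y : G) {p q : ℕ}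

lemma base_tuple (a : Fin p → C) (j : Fin (p + 1)) :
    base (tuple φ y a) j = φ (Fin.partialProd a j) := by
  rw [base, tuple, Fin.tail_cons, partialProd_comp]

lemma loop_tuple (a : Fin p → C) : loop (tuple φ y a) = y := by
  rw [loop, base_tuple, tuple, Fin.cons_zero, partialProd_comp, mul_inv_cancel_left]

lemma cycOp_tuple (hy : ∀ a, φ a * y = y * φ a) (α : Fin (q + 1) → Fin (p + 1)) (a : Fin p → C) :
    cycOp α (tuple φ y a) = tuple φ y (barOp α a) :=
  ext_base_loop (by ext j; simp [base_cycOp, base_tuple, partialProd_barOp])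
    (by rw [loop_cycOp, loop_tuple, loop_tuple, base_tuple, mul_assoc, ← hy, inv_mul_cancel_left])

lemma partialProd_barRot_succ (z : C) (a : Fin p → C) (k : Fin p) :
    Fin.partialProd (barRot z a) k.succ =
      z * (Fin.partialProd a (Fin.last p))⁻¹ * Fin.partialProd a k.castSucc := by
  cases p with
  | zero => exact k.elim0
  | succ p =>
    have h : Fin.tail (barRot z a) = Fin.init a := by
      ext i
      simp [Fin.tail, barRot, Fin.init, Fin.castSucc, Fin.castAdd, Fin.castLE]
    rw [Fin.partialProd_succ', h, Fin.partialProd_init]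
    simp [barRot]

lemma tuple_barRot (hy : ∀ a, φ a * y = y * φ a) (z : C) (hz : φ z = y) (a : Fin p → C) :
    tuple φ y (barRot z a) = rot (tuple φ y a) := by
  refine ext_base_loop ?_ ?_
  · ext j
    cases j using Fin.cases with
    | zero => rw [base_zero, base_zero]
    | succ k =>
      rw [base_tuple, partialProd_barRot_succ, base_rot_succ, loop_tuple, base_tuple, base_tuple,
        map_mul, map_mul, map_inv, hz, ← map_inv, ← hy]
  · rw [loop_rot, loop_tuple, loop_tuple, base_tuple, mul_assoc, ← hy, inv_mul_cancel_left]

lemma tuple_injective {φ : C →* G} (hφ : Function.Injective φ) :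
    Function.Injective (tuple φ y (p := p)) := fun a b h => by
  have := (Fin.cons_inj.mp h).2
  ext i
  exact hφ (congrFun this i)

end CyclicNerve

/-- For a homomorphism `φ : C →* G` with values in the centralizer of `y`, the simplicial map
`BC ⟶ N^{cy}(G)` sending `[a₁, …, a_p]` to `((φ a₁ ⋯ φ a_p)⁻¹ y, φ a₁, …, φ a_p)`. -/
def barToCyclicNerve {C G : Type u} [Group C] [Group G] (φ : C →* G) (y : G)
    (hy : ∀ a, φ a * y = y * φ a) : bar C ⟶ (cyclicNerve G).toSSet where
  app n := ↾fun a => tuple φ y (p := n.unop.len) a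
  naturality _ _ α := ConcreteCategory.hom_ext _ _ fun a =>
    (cycOp_tuple φ y hy α.unop.toOrderHom a).symm

/-- The twisted nerve `B(C, z)` of a group `C` and a central element `z`: the nerve of `C` with
the cyclic operator `[a₁, …, a_p] ↦ [z (a₁ ⋯ a_p)⁻¹, a₁, …, a_{p-1}]`. -/
def twistedNerve (C : Type u) [Group C] (z : C) (hz : ∀ a, a * z = z * a) : CyclicSet.{u} :=
  .ofEmbedding (cyclicNerve C) (bar C) (barToCyclicNerve (MonoidHom.id C) z hz)
    (fun _ => tuple_injective z Function.injective_id)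
    (fun _ a => barRot z a)
    (fun _ a => tuple_barRot (MonoidHom.id C) z hz z rfl a)

namespace ConjClasses

variable {G H : Type u} [Group G] [Group H]

/-- The canonical model `C_c` for the centralizer of an element of the conjugacy class `c`.
If `c ≠ ⟨1⟩`, an element of `C_c` is a family `(a_y)`, indexed by the elements `y` of `c`, with
`a_y` in the centralizer of `y`, which is compatible with all the conjugation isomorphisms between
the centralizers of the elements of `c`. If `c = ⟨1⟩`, then `C_c` is the group `G`, regarded as the
group of families indexed by the one-element set `c = {1}`. -/
def canonicalCentralizer (c : ConjClasses G) : Subgroup (c.carrier → G) where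
  carrier := {a | (∀ y : c.carrier, a y * y = y * a y) ∧
    (c ≠ 1 → ∀ (y y' : c.carrier) (h : G), (y' : G) = h⁻¹ * y * h → a y' = h⁻¹ * a y * h)}
  one_mem' := by
    refine ⟨fun y => by simp, fun _ y y' h _ => by simp⟩
  mul_mem' := by
    rintro a b ⟨ha, ha'⟩ ⟨hb, hb'⟩
    refine ⟨fun y => ?_, fun hc y y' h e => ?_⟩
    · rw [Pi.mul_apply, mul_assoc, hb, ← mul_assoc, ha, mul_assoc]
    · rw [Pi.mul_apply, Pi.mul_apply, ha' hc y y' h e, hb' hc y y' h e]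
      group
  inv_mem' := by
    rintro a ⟨ha, ha'⟩
    refine ⟨fun y => ?_, fun hc y y' h e => ?_⟩
    · rw [Pi.inv_apply, inv_mul_eq_iff_eq_mul, ← mul_assoc, ha, mul_inv_cancel_right]
    · rw [Pi.inv_apply, Pi.inv_apply, ha' hc y y' h e]
      group

/-- The evaluation `C_c → G`, `a ↦ a_y`, at an element `y` of the class `c`. -/
def evalAt (c : ConjClasses G) (y : c.carrier) : c.canonicalCentralizer →* G :=
  (Pi.evalMonoidHom (fun _ : c.carrier => G) y).comp c.canonicalCentralizer.subtype

/-- The element of `C_c` which corresponds to `y` in the centralizer of `y`, for all `y` in `c`. -/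
def canonicalElement (c : ConjClasses G) : c.canonicalCentralizer :=
  ⟨fun y => y, fun _ => rfl, fun _ _ _ _ e => e⟩

lemma evalAt_mul_comm (c : ConjClasses G) (y : c.carrier) (a : c.canonicalCentralizer) :
    c.evalAt y a * y = y * c.evalAt y a := a.2.1 y

lemma mul_canonicalElement (c : ConjClasses G) (a : c.canonicalCentralizer) :
    a * c.canonicalElement = c.canonicalElement * a := by
  apply Subtype.ext
  funext y
  exact a.2.1 y

/-- The image of an element of `c` under a homomorphism, as an element of the class `f(c)`. -/
def mapCarrier (f : G →* H) {c : ConjClasses G} (y : c.carrier) : (c.map f).carrier :=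
  ⟨f y, by
    obtain ⟨y, hy⟩ := y
    rw [mem_carrier_iff_mk_eq] at hy ⊢
    subst hy
    rfl⟩

lemma coe_eq_one_iff (c : ConjClasses G) (y : c.carrier) : (y : G) = 1 ↔ c = 1 := by
  obtain ⟨y, hy⟩ := y
  rw [mem_carrier_iff_mk_eq] at hy
  subst hy
  rw [one_eq_mk_one, mk_eq_mk_iff_isConj, isConj_comm, isConj_one_right]

lemma exists_conj {c : ConjClasses G} (y y' : c.carrier) : ∃ h : G, (y' : G) = h⁻¹ * y * h := by
  have hy := mem_carrier_iff_mk_eq.mp y.2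
  have hy' := mem_carrier_iff_mk_eq.mp y'.2
  obtain ⟨h, e⟩ := isConj_iff.mp (mk_eq_mk_iff_isConj.mp (hy.trans hy'.symm))
  exact ⟨h⁻¹, by rw [← e, inv_inv]⟩

lemma nonempty_carrier (c : ConjClasses G) : Nonempty c.carrier := by
  obtain ⟨y, hy⟩ := exists_rep c
  exact ⟨⟨y, mem_carrier_iff_mk_eq.mpr hy⟩⟩

/-- An element of `C_c` is determined by its component at one element of `c`. -/
lemma evalAt_injective (c : ConjClasses G) (y : c.carrier) : Function.Injective (c.evalAt y) := by
  intro a b h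
  apply Subtype.ext
  funext y'
  by_cases hc : c = 1
  · have : y' = y := Subtype.ext (by
      rw [(coe_eq_one_iff c y).mpr hc, (coe_eq_one_iff c y').mpr hc])
    rw [this]
    exact h
  · obtain ⟨k, e⟩ := exists_conj y y'
    rw [a.2.2 hc y y' k e, b.2.2 hc y y' k e]
    exact congrArg (fun u => k⁻¹ * u * k) h

/-- A homomorphism `f : G → H` of free groups induces a unique homomorphism `C_c → C_{f(c)}` given
on components by the restrictions `C_y → C_{f(y)}` of `f`. -/
lemma existsUnique_map [IsFreeGroup G] [IsFreeGroup H] (f : G →* H) (c : ConjClasses G) :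
    ∃! φ : c.canonicalCentralizer →* (c.map f).canonicalCentralizer,
      ∀ a y, (c.map f).evalAt (mapCarrier f y) (φ a) = f (c.evalAt y a) := by
  obtain ⟨y₀⟩ := nonempty_carrier c
  refine existsUnique_of_exists_of_unique ?_ ?_
  swap
  · intro φ ψ hφ hψ
    ext1 a
    exact evalAt_injective _ (mapCarrier f y₀) ((hφ a y₀).trans (hψ a y₀).symm)
  have key : ∀ a : c.canonicalCentralizer, ∃ b : (c.map f).canonicalCentralizer,
      ∀ y, (c.map f).evalAt (mapCarrier f y) b = f (c.evalAt y a) := by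
    intro a
    by_cases hfc : c.map f = 1
    · have hconst : ∀ y, f (c.evalAt y a) = f (c.evalAt y₀ a) := by
        intro y
        by_cases hc : c = 1
        · have : y = y₀ := Subtype.ext (by
            rw [(coe_eq_one_iff c y).mpr hc, (coe_eq_one_iff c y₀).mpr hc])
          rw [this]
        · have h1 : ∀ y : c.carrier, f (c.evalAt y a) = 1 := fun y =>
            FreeGroupFacts.map_eq_one f (fun h => hc ((coe_eq_one_iff c y).mp h))
              (c.evalAt_mul_comm y a) ((coe_eq_one_iff _ (mapCarrier f y)).mpr hfc)
          rw [h1, h1]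
      refine ⟨⟨fun _ => f (c.evalAt y₀ a), fun y => ?_, fun h => absurd hfc h⟩, fun y => ?_⟩
      · rw [(coe_eq_one_iff _ y).mpr hfc, one_mul, mul_one]
      · exact (hconst y).symm
    · have hc : c ≠ 1 := by
        rintro rfl
        apply hfc
        rw [one_eq_mk_one, one_eq_mk_one, ← map_one f]
        rfl
      choose k hk using fun y' : (c.map f).carrier => exists_conj (mapCarrier f y₀) y'
      have hne : f (y₀ : G) ≠ 1 := fun h => hfc ((coe_eq_one_iff _ (mapCarrier f y₀)).mp h)
      have hcomm : f (c.evalAt y₀ a) * f y₀ = f y₀ * f (c.evalAt y₀ a) := by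
        rw [← map_mul, ← map_mul, c.evalAt_mul_comm y₀ a]
      have hk' : ∀ y' : (c.map f).carrier, (y' : H) = (k y')⁻¹ * f y₀ * k y' := hk
      -- independence of the conjugating element
      have hind : ∀ u v : H, u⁻¹ * f y₀ * u = v⁻¹ * f y₀ * v →
          u⁻¹ * f (c.evalAt y₀ a) * u = v⁻¹ * f (c.evalAt y₀ a) * v := by
        intro u v h
        have h1 : (u * v⁻¹) * f y₀ = f y₀ * (u * v⁻¹) := by
          calc (u * v⁻¹) * f y₀ = u * (v⁻¹ * f y₀ * v) * v⁻¹ := by group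
            _ = u * (u⁻¹ * f y₀ * u) * v⁻¹ := by rw [h]
            _ = f y₀ * (u * v⁻¹) := by group
        have h2 := FreeGroupFacts.commute_of_commute hne hcomm h1
        calc u⁻¹ * f (c.evalAt y₀ a) * u
            = u⁻¹ * (f (c.evalAt y₀ a) * (u * v⁻¹)) * v := by group
          _ = u⁻¹ * ((u * v⁻¹) * f (c.evalAt y₀ a)) * v := by rw [h2]
          _ = v⁻¹ * f (c.evalAt y₀ a) * v := by group
      refine ⟨⟨fun y' => (k y')⁻¹ * f (c.evalAt y₀ a) * k y', fun y' => ?_,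
        fun _ y y' h e => ?_⟩, fun y => ?_⟩
      · conv_lhs => rw [hk' y']
        conv_rhs => rw [hk' y']
        calc _ = (k y')⁻¹ * (f (c.evalAt y₀ a) * f y₀) * k y' := by group
          _ = _ := by rw [hcomm]; group
      · have := hind (k y') (k y * h) (by
          rw [← hk' y', e, hk' y]; group)
        refine this.trans ?_
        group
      · obtain ⟨h, e⟩ := exists_conj y₀ y
        have h1 : c.evalAt y a = h⁻¹ * c.evalAt y₀ a * h := a.2.2 hc y₀ y h e
        have h2 := hind (k (mapCarrier f y)) (f h) (by
          rw [← hk' (mapCarrier f y)]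
          simp [mapCarrier, e])
        rw [h1, map_mul, map_mul, map_inv]
        exact h2
  choose φ hφ using key
  refine ⟨MonoidHom.mk' φ fun a b => evalAt_injective _ (mapCarrier f y₀) ?_, hφ⟩
  rw [map_mul, hφ, hφ, hφ, map_mul, map_mul]

/-- The homomorphism `C_c → C_{f(c)}` induced by a homomorphism `f` of free groups. -/
noncomputable def canonicalMap [IsFreeGroup G] [IsFreeGroup H] (f : G →* H) (c : ConjClasses G) :
    c.canonicalCentralizer →* (c.map f).canonicalCentralizer :=
  (existsUnique_map f c).choose

lemma evalAt_canonicalMap [IsFreeGroup G] [IsFreeGroup H] (f : G →* H) (c : ConjClasses G)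
    (a : c.canonicalCentralizer) (y : c.carrier) :
    (c.map f).evalAt (mapCarrier f y) (c.canonicalMap f a) = f (c.evalAt y a) :=
  (existsUnique_map f c).choose_spec.1 a y

lemma canonicalMap_canonicalElement [IsFreeGroup G] [IsFreeGroup H] (f : G →* H)
    (c : ConjClasses G) :
    c.canonicalMap f c.canonicalElement = (c.map f).canonicalElement := by
  obtain ⟨y₀⟩ := nonempty_carrier c
  exact evalAt_injective _ (mapCarrier f y₀) (evalAt_canonicalMap f c _ y₀)

end ConjClasses

open ConjClasses

lemma CyclicNerve.barRot_map {C D : Type u} [Group C] [Group D] (φ : C →* D) {z : C} {w : D}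
    (h : φ z = w) {p : ℕ} (a : Fin p → C) : φ ∘ barRot z a = barRot w (φ ∘ a) := by
  funext i
  simp only [barRot, partialProd_comp, Function.comp_apply, ← h]
  split <;> simp

/-- The map `B(C, z) ⟶ B(D, w)` induced by a homomorphism `φ` with `φ z = w`. -/
def twistedNerveMap {C D : Type u} [Group C] [Group D] {z : C} {hz : ∀ a, a * z = z * a} {w : D}
    {hw : ∀ a, a * w = w * a} (φ : C →* D) (h : φ z = w) :
    twistedNerve C z hz ⟶ twistedNerve D w hw where
  toSSetHom :=
    { app := fun n => ↾fun a => φ ∘ (a : Fin n.unop.len → C)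
      naturality := fun _ _ α => ConcreteCategory.hom_ext _ _ fun a =>
        (barOp_map φ α.unop.toOrderHom a).symm }
  comm _ a := barRot_map φ h a

/-- The summand `BC_c = B(C_c, c)`, with the cyclic structure given by the canonical element. -/
def centralizerNerve {G : Type u} [Group G] (c : ConjClasses G) : CyclicSet.{u} :=
  twistedNerve c.canonicalCentralizer c.canonicalElement c.mul_canonicalElement

/-- The disjoint union of the `BC_c` over all conjugacy classes `c` of `G`. -/
def centralizerNerves (G : Type u) [Group G] : CyclicSet.{u} :=
  .sigma fun c : ConjClasses G => centralizerNerve c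

/-- The conjugacy class of the product `g₀ g₁ ⋯ g_p`. -/
def CyclicNerve.cycClass {G : Type u} [Group G] {p : ℕ} (g : Fin (p + 1) → G) : ConjClasses G :=
  ConjClasses.mk (Fin.partialProd g (Fin.last (p + 1)))

namespace CyclicNerve

variable {G : Type u} [Group G] {p q : ℕ}

lemma cycClass_eq_mk_loop (g : Fin (p + 1) → G) : cycClass g = ConjClasses.mk (loop g) := by
  rw [cycClass, mk_eq_mk_iff_isConj, isConj_iff, ← Fin.succ_last, Fin.partialProd_succ']
  refine ⟨(g 0)⁻¹, ?_⟩
  rw [inv_inv, inv_mul_cancel_left]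
  rfl

lemma mk_conj (h x : G) : ConjClasses.mk (h⁻¹ * x * h) = ConjClasses.mk x := by
  rw [mk_eq_mk_iff_isConj, isConj_comm, isConj_iff]
  exact ⟨h⁻¹, by rw [inv_inv]⟩

lemma cycClass_cycOp (α : Fin (q + 1) → Fin (p + 1)) (g : Fin (p + 1) → G) :
    cycClass (cycOp α g) = cycClass g := by
  rw [cycClass_eq_mk_loop, cycClass_eq_mk_loop, loop_cycOp, mk_conj]

lemma cycClass_tuple {C : Type u} [Group C] (φ : C →* G) (y : G) (a : Fin p → C) :
    cycClass (tuple φ y a) = ConjClasses.mk y := by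
  rw [cycClass_eq_mk_loop, loop_tuple]

lemma cycClass_rot (g : Fin (p + 1) → G) : cycClass (rot g) = cycClass g := by
  rw [cycClass_eq_mk_loop, cycClass_eq_mk_loop, loop_rot, mk_conj]

end CyclicNerve

/-- The cyclic subset `N^{cy}(G)_c` of the tuples `(g₀, …, g_p)` with `g₀ g₁ ⋯ g_p` in `c`. -/
def cyclicNerveComponent {G : Type u} [Group G] (c : ConjClasses G) : CyclicSet.{u} :=
  let A : (cyclicNerve G).toSSet.Subcomplex :=
    { obj := fun n => {g | cycClass (p := n.unop.len) g = c}
      map := fun α g hg => (cycClass_cycOp α.unop.toOrderHom g).trans hg }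
  .ofEmbedding (cyclicNerve G) A A.ι (fun _ => Subtype.val_injective)
    (fun n g => ⟨rot (p := n) g.1, (cycClass_rot (p := n) g.1).trans g.2⟩) (fun _ _ => rfl)

/-- The inclusion `N^{cy}(G)_c ⟶ N^{cy}(G)`. -/
def cyclicNerveComponentι {G : Type u} [Group G] (c : ConjClasses G) :
    cyclicNerveComponent c ⟶ cyclicNerve G where
  toSSetHom :=
    { app := fun _ => ↾fun g => g.1
      naturality := fun _ _ _ => rfl }
  comm _ _ := rfl

lemma cyclicNerveComponent_ext {G : Type u} [Group G] {n : SimplexCategoryᵒᵖ}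
    (x x' : (CyclicSet.sigma fun c : ConjClasses G => cyclicNerveComponent c).toSSet.obj n)
    (h : x.2.1 = x'.2.1) : x = x' := by
  obtain ⟨c, g, hg⟩ := x
  obtain ⟨c', g', hg'⟩ := x'
  obtain rfl : g = g' := h
  obtain rfl : c = c' := Eq.trans (Eq.symm hg) hg'
  rfl

/-- The decomposition of `N^{cy}(G)` as the disjoint union of the `N^{cy}(G)_c`. -/
def cyclicNerveDecomposition (G : Type u) [Group G] :
    CyclicSet.sigma (fun c : ConjClasses G => cyclicNerveComponent c) ≅ cyclicNerve G where
  hom := CyclicSet.sigmaDesc fun c => cyclicNerveComponentι c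
  inv :=
    { toSSetHom :=
        { app := fun n => ↾fun g => ⟨cycClass (p := n.unop.len) g, g, rfl⟩
          naturality := fun _ _ _ => ConcreteCategory.hom_ext _ _ fun _ =>
            by refine cyclicNerveComponent_ext _ _ ?_; rfl }
      comm := fun _ _ => by refine cyclicNerveComponent_ext _ _ ?_; rfl }
  hom_inv_id := CyclicSet.hom_ext (SSet.hom_ext fun _ => ConcreteCategory.hom_ext _ _ fun _ =>
    by refine cyclicNerveComponent_ext _ _ ?_; rfl)
  inv_hom_id := rfl

/-- For `y` in the conjugacy class `c`, the map `BC_c ⟶ N^{cy}(G)_c` which sends `[a₁, …, a_p]` to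
`((a₁ ⋯ a_p)⁻¹ y, a₁, …, a_p)`, where `C_c` is identified with the centralizer of `y` by evaluation
at `y`. -/
def centralizerNerveMap {G : Type u} [Group G] (c : ConjClasses G) (y : c.carrier) :
    centralizerNerve c ⟶ cyclicNerveComponent c where
  toSSetHom :=
    { app := fun n => ↾fun a => ⟨tuple (c.evalAt y) y (p := n.unop.len) a,
        (cycClass_tuple _ _ _).trans (mem_carrier_iff_mk_eq.mp y.2)⟩
      naturality := fun _ _ α => ConcreteCategory.hom_ext _ _ fun a => Subtype.ext
        (cycOp_tuple (c.evalAt y) y (c.evalAt_mul_comm y) α.unop.toOrderHom a).symm }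
  comm _ a := Subtype.ext
    (tuple_barRot (c.evalAt y) y (c.evalAt_mul_comm y) c.canonicalElement rfl a)

/-- For a choice `b` of an element in every conjugacy class of `G`, the map
`∐ BC_c ⟶ ∐ N^{cy}(G)_c` given by the maps `BC_c ⟶ N^{cy}(G)_c` for these elements. -/
def centralizerNervesMap {G : Type u} [Group G] (b : ∀ c : ConjClasses G, c.carrier) :
    centralizerNerves G ⟶ .sigma fun c : ConjClasses G => cyclicNerveComponent c :=
  CyclicSet.sigmaMap id fun c => centralizerNerveMap c (b c)

/-- The category of free groups. -/
abbrev FreeGrp : Type (u + 1) :=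
  ObjectProperty.FullSubcategory fun G : GrpCat.{u} => IsFreeGroup G

instance (G : FreeGrp.{u}) : IsFreeGroup G.obj := G.property

/-- The functor `G ↦ N^{cy}(G)`. -/
def cyclicNerveFunctor : FreeGrp.{u} ⥤ CyclicSet.{u} where
  obj G := cyclicNerve G.obj
  map f := cyclicNerveMap f.hom.hom
  map_id _ := rfl
  map_comp _ _ := rfl

lemma centralizerNerves_ext {G : Type u} [Group G] {n : SimplexCategoryᵒᵖ}
    (x x' : (centralizerNerves G).toSSet.obj n) (y : G) (hy : y ∈ x.1.carrier)
    (hy' : y ∈ x'.1.carrier)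
    (h : ∀ i : Fin n.unop.len, x.1.evalAt ⟨y, hy⟩ (x.2 i) = x'.1.evalAt ⟨y, hy'⟩ (x'.2 i)) :
    x = x' := by
  obtain ⟨c, a⟩ := x
  obtain ⟨c', a'⟩ := x'
  obtain rfl : c = c' :=
    (mem_carrier_iff_mk_eq.mp hy).symm.trans (mem_carrier_iff_mk_eq.mp hy')
  exact congrArg (Sigma.mk c) (funext fun i => evalAt_injective c ⟨y, hy⟩ (h i))

/-- The functor `G ↦ ∐ BC_c` on free groups; a homomorphism `f` maps the summand of `c` to the
summand of `f(c)` by the homomorphism `C_c → C_{f(c)}` induced by `f`. -/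
noncomputable def centralizerNervesFunctor : FreeGrp.{u} ⥤ CyclicSet.{u} where
  obj G := centralizerNerves G.obj
  map {G H} f := CyclicSet.sigmaMap (ConjClasses.map f.hom.hom) fun c =>
    twistedNerveMap (c.canonicalMap f.hom.hom) (canonicalMap_canonicalElement f.hom.hom c)
  map_id G := by
    refine CyclicSet.hom_ext (SSet.hom_ext fun n => ConcreteCategory.hom_ext _ _ fun x => ?_)
    obtain ⟨y⟩ := nonempty_carrier x.1
    exact centralizerNerves_ext _ _ (y : G.obj) (mapCarrier (𝟙 G : G ⟶ G).hom.hom y).2 y.2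
      fun i => evalAt_canonicalMap (𝟙 G : G ⟶ G).hom.hom x.1 (x.2 i) y
  map_comp {G H K} f g := by
    refine CyclicSet.hom_ext (SSet.hom_ext fun n => ConcreteCategory.hom_ext _ _ fun x => ?_)
    obtain ⟨y⟩ := nonempty_carrier x.1
    refine centralizerNerves_ext _ _ (g.hom.hom (f.hom.hom (y : G.obj)))
      (mapCarrier (f ≫ g).hom.hom y).2 (mapCarrier g.hom.hom (mapCarrier f.hom.hom y)).2
      fun i => ?_
    refine (evalAt_canonicalMap (f ≫ g).hom.hom x.1 (x.2 i) y).trans (Eq.symm ?_)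
    refine (evalAt_canonicalMap g.hom.hom _ (x.1.canonicalMap f.hom.hom (x.2 i))
      (mapCarrier f.hom.hom y)).trans ?_
    exact congrArg g.hom.hom (evalAt_canonicalMap f.hom.hom x.1 (x.2 i) y)

/-- The standard homotopy from the identity of `N^{cy}(G)` to the map `(gᵢ) ↦ (h⁻¹ gᵢ h)`, evaluated
at a tuple `g` in `N^{cy}(G)_p` and a `p`-simplex `s : [p] → [1]` of `Δ[1]`: with `hᵢ = 1` if
`s i = 0` and `hᵢ = h` if `s i = 1`, it is the tuple `(h_{i-1}⁻¹ gᵢ hᵢ)`, indices modulo `p + 1`. -/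
def conjugationHomotopy {G : Type u} [Group G] (h : G) {p : ℕ} (g : Fin (p + 1) → G)
    (s : Fin (p + 1) → Fin 2) : Fin (p + 1) → G :=
  fun i => (if s (i - 1) = 1 then h else 1)⁻¹ * g i * (if s i = 1 then h else 1)

/-- A family `(h_c)` of elements of `H` which conjugates the images under `f` of the chosen elements
of the conjugacy classes of `G` to the chosen elements of the conjugacy classes of `H`. -/
def IsConjugating {G H : FreeGrp.{u}} (f : G ⟶ H) (b : ∀ c : ConjClasses G.obj, c.carrier)
    (b' : ∀ c : ConjClasses H.obj, c.carrier) (h : ConjClasses G.obj → H.obj) : Prop :=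
  h 1 = 1 ∧ ∀ c, (h c)⁻¹ * f.hom.hom (b c) * h c = b' (c.map f.hom.hom)

/-- The square formed by `∐ BC_c ⟶ N^{cy}(G)`, `∐ BC_d ⟶ N^{cy}(H)` and the maps induced by
`f : G ⟶ H` commutes up to canonical homotopy: conjugating families `(h_c)` exist, and for each
of them the standard homotopies from the identity of `N^{cy}(H)` to the conjugations by the `h_c`
are a homotopy from one composite to the other one. -/
def CommutesUpToCanonicalHomotopy {G H : FreeGrp.{u}} (f : G ⟶ H)
    (b : ∀ c : ConjClasses G.obj, c.carrier) (b' : ∀ c : ConjClasses H.obj, c.carrier) : Prop :=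
  (∃ h, IsConjugating f b b' h) ∧ ∀ h, IsConjugating f b b' h →
    let top : centralizerNerves G.obj ⟶ cyclicNerve H.obj :=
      centralizerNervesMap b ≫ (cyclicNerveDecomposition G.obj).hom ≫ cyclicNerveFunctor.map f
    let bottom : centralizerNerves G.obj ⟶ cyclicNerve H.obj :=
      centralizerNervesFunctor.map f ≫ centralizerNervesMap b' ≫
        (cyclicNerveDecomposition H.obj).hom
    ∃ K : SSet.Homotopy top.toSSetHom bottom.toSSetHom,
      ∀ (p : ℕ) (x : (centralizerNerves G.obj).toSSet _⦋p⦌) (s : (Δ[1] : SSet.{u}) _⦋p⦌),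
        K.h.app (op ⦋p⦌) (x, s) =
          conjugationHomotopy (h x.1) (top.toSSetHom.app (op ⦋p⦌) x) s

/-! A tuple `g` in the cyclic nerve is a simplex of the nerve of the groupoid of `G` acting on
itself by conjugation: its vertices are the conjugates `vertex g j` of `loop g`, and its edges are
the entries `g 1, …, g p`. The subset belonging to a class `c` is the nerve of a connected
component. The image of `BC_c` consists of the simplices all of whose vertices are the chosen `y`,
so it is the nerve of the automorphism group of one object. Conjugating each vertex `x` to `y` by a
chosen `k x`, with `k y = 1`, is a natural transformation from the identity to a retraction. In
tuples it is the operation `twist`, and it yields `centralizerNerveDeformation`, whence the weak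
equivalences.

Freeness enters through centralizers. Those of nontrivial elements are infinite cyclic, hence
abelian, so conjugation between the centralizers of two elements of `c ≠ 1` does not depend on the
conjugator. This makes evaluation on `C_c` an isomorphism onto each centralizer (`range_evalAt`) and
gives the canonical root (`existsUnique_root`).

The statements about simplicial operators and about morphisms are one assertion about a homomorphism
of free groups, `commutesUpToCanonicalHomotopy`. On the summand of `c` the two composites differ by
conjugation with `h c`. This is checked on centralizers in `IsConjugating.evalAt_canonicalMap`,
where torsion-freeness covers the nontrivial classes that are mapped to the trivial class. -/

namespace FreeGroupFacts

/-! ### Roots and centralizers in free groups. -/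

variable {G : Type u} [Group G] [IsFreeGroup G]

lemma isMulTorsionFree : IsMulTorsionFree G :=
  Function.Injective.isMulTorsionFree (IsFreeGroup.toFreeGroup G).toMonoidHom
    (IsFreeGroup.toFreeGroup G).injective

/-- The centralizer of a nontrivial element `y` of a free group is generated by a positive root
of `y`. -/
lemma exists_positive_root {y : G} (hy : y ≠ 1) :
    ∃ r : G, Subgroup.zpowers r = Subgroup.centralizer {y} ∧ ∃ k : ℕ, 0 < k ∧ r ^ k = y := by
  obtain ⟨r, hr⟩ := exists_generator_centralizer hy
  obtain ⟨k, hk⟩ := hr y rfl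
  have hz : Subgroup.zpowers r = Subgroup.centralizer {y} := by
    apply le_antisymm
    · rw [Subgroup.zpowers_le, Subgroup.mem_centralizer_singleton_iff, hk]
      exact (Commute.refl r).zpow_right k
    · intro a ha
      rw [Subgroup.mem_centralizer_singleton_iff] at ha
      obtain ⟨l, hl⟩ := hr a ha
      exact Subgroup.mem_zpowers_iff.mpr ⟨l, hl.symm⟩
  have hk0 : k ≠ 0 := by
    rintro rfl
    exact hy (by simpa using hk)
  rcases lt_or_gt_of_ne hk0 with h | h
  -- If `y` is a negative power of the generator, the inverse generator is the positive root.
  · refine ⟨r⁻¹, by rw [Subgroup.zpowers_inv, hz], (-k).toNat, by omega, ?_⟩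
    rw [← zpow_natCast, Int.toNat_of_nonneg (by omega), zpow_neg, inv_zpow, inv_inv, hk]
  · exact ⟨r, hz, k.toNat, by omega, by
      rw [← zpow_natCast, Int.toNat_of_nonneg h.le, hk]⟩

/-- Two generators of an infinite cyclic group are equal or mutually inverse; the natural exponents
`k`, `k'` exclude the second case. -/
lemma positive_root_unique {y r r' : G} (hy : y ≠ 1)
    (hz : Subgroup.zpowers r = Subgroup.zpowers r') {k k' : ℕ} (hk : r ^ k = y)
    (hk' : r' ^ k' = y) : r = r' := by
  have := isMulTorsionFree (G := G)
  have hr : r ≠ 1 := by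
    rintro rfl
    exact hy (by rw [← hk, one_pow])
  have hinj : ∀ n : ℤ, r ^ n = 1 → n = 0 := by
    intro n hn
    by_contra h0
    exact hr (zpow_left_injective h0 (by simpa using hn))
  obtain ⟨m, hm⟩ := Subgroup.mem_zpowers_iff.mp (hz ▸ Subgroup.mem_zpowers r' : r' ∈ _)
  obtain ⟨l, hl⟩ := Subgroup.mem_zpowers_iff.mp (hz ▸ Subgroup.mem_zpowers r : r ∈ _)
  have hml : m * l - 1 = 0 := hinj _ (by rw [zpow_sub_one, zpow_mul, hm, hl, mul_inv_cancel])
  have hmk : m * k' - k = 0 := hinj _ (by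
    rw [zpow_sub, zpow_mul, hm, zpow_natCast, zpow_natCast, hk, hk', mul_inv_cancel])
  have hk0 : k ≠ 0 := by
    rintro rfl
    exact hy (by rw [← hk, pow_zero])
  rcases Int.eq_one_or_neg_one_of_mul_eq_one (show m * l = 1 by omega) with rfl | rfl
  · rw [← hm, zpow_one]
  -- Here `m = -1`, so `k = -k'` with both natural, which forces `k = 0`.
  · omega

end FreeGroupFacts

/-! ### The group `C_c` as a model of the centralizers. -/

namespace ConjClasses

variable {G : Type u} [Group G] [IsFreeGroup G]

/-- An element `a` of the centralizer of `y` is spread over `c` by conjugation. Two conjugators from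
`y` to the same element differ by an element of that centralizer, which commutes with `a` when `y ≠
1`. -/
lemma range_evalAt (c : ConjClasses G) (y : c.carrier) :
    (c.evalAt y).range = Subgroup.centralizer {(y : G)} := by
  apply le_antisymm
  · rintro _ ⟨a, rfl⟩
    exact Subgroup.mem_centralizer_singleton_iff.mpr (c.evalAt_mul_comm y a)
  · intro a ha
    rw [Subgroup.mem_centralizer_singleton_iff] at ha
    by_cases hc : c = 1
    -- For the trivial class no compatibility is imposed, so any constant family is allowed although
    -- `G` need not be abelian.
    · refine ⟨⟨fun _ => a, fun y' => ?_, fun h => absurd hc h⟩, rfl⟩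
      rw [(coe_eq_one_iff c y').mpr hc, one_mul, mul_one]
    have hy : (y : G) ≠ 1 := fun h => hc ((coe_eq_one_iff c y).mp h)
    choose k hk using fun y' : c.carrier => exists_conj y y'
    -- The conjugate of `a` depends only on the conjugate of `y`.
    have hind : ∀ u v : G, u⁻¹ * y * u = v⁻¹ * y * v → u⁻¹ * a * u = v⁻¹ * a * v := by
      intro u v h
      have h1 : (u * v⁻¹) * y = y * (u * v⁻¹) := by
        calc (u * v⁻¹) * y = u * (v⁻¹ * y * v) * v⁻¹ := by group
          _ = u * (u⁻¹ * y * u) * v⁻¹ := by rw [h]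
          _ = y * (u * v⁻¹) := by group
      have h2 := FreeGroupFacts.commute_of_commute hy ha h1
      calc u⁻¹ * a * u = u⁻¹ * (a * (u * v⁻¹)) * v := by group
        _ = u⁻¹ * ((u * v⁻¹) * a) * v := by rw [h2]
        _ = v⁻¹ * a * v := by group
    refine ⟨⟨fun y' => (k y')⁻¹ * a * k y', fun y' => ?_, fun _ y₁ y₂ h e => ?_⟩, ?_⟩
    · conv_lhs => rw [hk y']
      conv_rhs => rw [hk y']
      calc _ = (k y')⁻¹ * (a * y) * k y' := by group
        _ = _ := by rw [ha]; group
    · refine (hind (k y₂) (k y₁ * h) ?_).trans (by group)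
      rw [← hk y₂, e, hk y₁]
      group
    · refine (hind (k y) 1 ?_).trans (by group)
      rw [← hk y]
      group

lemma evalAt_conj {G : Type u} [Group G] {c : ConjClasses G} (hc : c ≠ 1)
    (a : c.canonicalCentralizer) {y y' : c.carrier} {h : G} (e : (y' : G) = h⁻¹ * y * h) :
    c.evalAt y' a = h⁻¹ * c.evalAt y a * h :=
  a.2.2 hc y y' h e

/-- Generating the group and having the canonical element as a positive power are properties of `r`
inside `C_c`. Checked at one `y₀`, they pass to every `y` because all evaluations are isomorphisms
onto centralizers. -/
lemma existsUnique_root {c : ConjClasses G} (hc : c ≠ 1) :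
    ∃! r : c.canonicalCentralizer, ∀ y : c.carrier,
      Subgroup.zpowers (c.evalAt y r) = Subgroup.centralizer {(y : G)} ∧
        ∃ k : ℕ, 0 < k ∧ c.evalAt y r ^ k = y := by
  obtain ⟨y₀⟩ := nonempty_carrier c
  have hy : (y₀ : G) ≠ 1 := fun h => hc ((coe_eq_one_iff c y₀).mp h)
  obtain ⟨r₀, hz₀, k, hk, hrk⟩ := FreeGroupFacts.exists_positive_root hy
  have hmem : r₀ ∈ (c.evalAt y₀).range := by
    rw [range_evalAt, ← hz₀]
    exact Subgroup.mem_zpowers r₀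
  obtain ⟨r, rfl⟩ := hmem
  refine ⟨r, fun y => ?_, fun r' hr' => ?_⟩
  · have hpow : r ^ k = c.canonicalElement :=
      evalAt_injective c y₀ ((map_pow _ _ _).trans hrk)
    refine ⟨?_, k, hk, by rw [← map_pow, hpow]; rfl⟩
    have hgen : Subgroup.zpowers r = ⊤ := by
      refine Subgroup.map_injective (evalAt_injective c y₀) ?_
      rw [MonoidHom.map_zpowers, hz₀, ← MonoidHom.range_eq_map, range_evalAt]
    rw [← range_evalAt, ← MonoidHom.map_zpowers, hgen, MonoidHom.range_eq_map]
  · obtain ⟨hz', k', -, hk'⟩ := hr' y₀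
    exact evalAt_injective c y₀
      (FreeGroupFacts.positive_root_unique hy (hz'.trans hz₀.symm) hk' hrk)

end ConjClasses

/-! ### Twisting tuples, and the vertices of a tuple. -/

namespace CyclicNerve

variable {G : Type u} [Group G] {p q : ℕ}

/-- The tuple `(κ_{i-1}⁻¹ gᵢ κᵢ)`, indices modulo `p + 1`. -/
def twist (κ : Fin (p + 1) → G) (g : Fin (p + 1) → G) : Fin (p + 1) → G :=
  fun i => (κ (i - 1))⁻¹ * g i * κ i

/-- The inner factors of `κ` telescope. -/
lemma base_twist (κ g : Fin (p + 1) → G) (j : Fin (p + 1)) :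
    base (twist κ g) j = (κ 0)⁻¹ * base g j * κ j := by
  induction j using Fin.induction with
  | zero => simp [base_zero]
  | succ i ih =>
    rw [base, base] at *
    have h : i.succ - 1 = i.castSucc := by rw [← Fin.coeSucc_eq_succ, add_sub_cancel_right]
    rw [Fin.partialProd_succ, ih, Fin.partialProd_succ, Fin.tail, twist, h, Fin.tail]
    group

lemma loop_twist (κ g : Fin (p + 1) → G) : loop (twist κ g) = (κ 0)⁻¹ * loop g * κ 0 := by
  -- Indices are cyclic: entry `0` starts with the inverse of the last `κ`, which cancels the end of
  -- `base`.
  have h : (0 : Fin (p + 1)) - 1 = Fin.last p := by rw [sub_eq_iff_eq_add]; simp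
  rw [loop, base_twist, twist, h, loop]
  group

/-- The function `κ` lives on vertices and is therefore pulled back along `α`. All simplicial
homotopies on cyclic nerves below get their naturality from this. -/
lemma cycOp_twist (α : Fin (q + 1) → Fin (p + 1)) (κ g : Fin (p + 1) → G) :
    cycOp α (twist κ g) = twist (κ ∘ α) (cycOp α g) :=
  ext_base_loop (by ext j; simp only [base_cycOp, base_twist, Function.comp_apply]; group)
    (by simp only [loop_cycOp, base_twist, loop_twist, Function.comp_apply]; group)

lemma twist_one (g : Fin (p + 1) → G) : twist (fun _ => 1) g = g := by
  ext i
  simp [twist]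

lemma cycClass_twist (κ g : Fin (p + 1) → G) : cycClass (twist κ g) = cycClass g := by
  rw [cycClass_eq_mk_loop, cycClass_eq_mk_loop, loop_twist, mk_conj]

/-- A tuple `g` defines a `p`-simplex of the nerve of the groupoid given by the conjugation action
of `G` on itself; these are the vertices of the simplex. -/
def vertex (g : Fin (p + 1) → G) (j : Fin (p + 1)) : G := (base g j)⁻¹ * loop g * base g j

lemma vertex_cycOp (α : Fin (q + 1) → Fin (p + 1)) (g : Fin (p + 1) → G) (j : Fin (q + 1)) :
    vertex (cycOp α g) j = vertex g (α j) := by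
  rw [vertex, vertex, base_cycOp, loop_cycOp]
  group

lemma vertex_twist (κ g : Fin (p + 1) → G) (j : Fin (p + 1)) :
    vertex (twist κ g) j = (κ j)⁻¹ * vertex g j * κ j := by
  rw [vertex, vertex, base_twist, loop_twist]
  group

lemma mk_vertex (g : Fin (p + 1) → G) (j : Fin (p + 1)) :
    ConjClasses.mk (vertex g j) = cycClass g := by
  rw [vertex, mk_conj, cycClass_eq_mk_loop]

/-- The partial products lie in the centralizer of `y`, so moving along edges never changes the
vertex. -/
lemma vertex_tuple {C : Type u} [Group C] (φ : C →* G) (y : G) (hy : ∀ a, φ a * y = y * φ a)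
    (a : Fin p → C) (j : Fin (p + 1)) : vertex (tuple φ y a) j = y := by
  rw [vertex, base_tuple, loop_tuple, mul_assoc, ← hy, inv_mul_cancel_left]

/-- The tuples all of whose vertices are `y` come from the nerve of the centralizer of `y`. -/
lemma exists_tuple_eq {C : Type u} [Group C] (φ : C →* G) (y : G)
    (hφ : φ.range = Subgroup.centralizer {y}) (g : Fin (p + 1) → G) (hg : ∀ j, vertex g j = y) :
    ∃ a : Fin p → C, tuple φ y a = g := by
  have hloop : loop g = y := by simpa [vertex, base_zero] using hg 0
  -- Since `loop g = y`, having `y` as the `j`-th vertex means that `base g j` commutes with `y`.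
  have hbase : ∀ j, base g j ∈ Subgroup.centralizer {y} := fun j => by
    have := hg j
    rw [vertex, hloop, mul_assoc, inv_mul_eq_iff_eq_mul] at this
    exact Subgroup.mem_centralizer_singleton_iff.mpr this.symm
  -- Each edge is a quotient of two consecutive partial products.
  have hmem : ∀ i : Fin p, ∃ a, φ a = g i.succ := fun i => by
    rw [← MonoidHom.mem_range, hφ]
    have := mul_mem (inv_mem (hbase i.castSucc)) (hbase i.succ)
    rwa [base, Fin.partialProd_right_inv] at this
  choose a ha using hmem
  have hb : base (tuple φ y a) = base g := by
    rw [base, base, tuple, Fin.tail_cons]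
    congr 1
    ext i
    exact ha i
  -- Entry `0` is not lifted; it is determined by the other entries and `loop`.
  exact ⟨a, ext_base_loop hb ((loop_tuple φ y a).trans hloop.symm)⟩

/-- By definition `conjugationHomotopy` is a `twist` whose `κ` takes only the values `1` and `h`. -/
lemma cycOp_conjugationHomotopy (α : Fin (q + 1) → Fin (p + 1)) (h : G) (g : Fin (p + 1) → G)
    (s : Fin (p + 1) → Fin 2) :
    cycOp α (conjugationHomotopy h g s) = conjugationHomotopy h (cycOp α g) (s ∘ α) :=
  cycOp_twist α (fun i => if s i = 1 then h else 1) g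

end CyclicNerve

/-! ### Simplicial homotopies and deformation retractions. -/

/-- A simplicial homotopy, given by its values on pairs of a simplex of `X` and a map
`[p] → [1]`. -/
def SSet.Homotopy.ofFamily {X Y : SSet.{u}} {f g : X ⟶ Y}
    (h : ∀ n : SimplexCategoryᵒᵖ, X.obj n → (Fin (n.unop.len + 1) → Fin 2) → Y.obj n)
    (nat : ∀ (m n : SimplexCategoryᵒᵖ) (α : m ⟶ n) (x : X.obj m) (s : Fin (m.unop.len + 1) → Fin 2),
      h n (X.map α x) (s ∘ α.unop.toOrderHom) = Y.map α (h m x s))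
    (h_zero : ∀ n x, h n x (fun _ => 0) = f.app n x)
    (h_one : ∀ n x, h n x (fun _ => 1) = g.app n x) : SSet.Homotopy f g where
  h :=
    { app := fun n => ↾fun x =>
        h n x.1 (fun j => (SSet.stdSimplex.objEquiv x.2).toOrderHom j)
      naturality := fun m n α => ConcreteCategory.hom_ext _ _ fun x => nat m n α x.1 _ }
  h₀ := SSet.hom_ext fun n => ConcreteCategory.hom_ext _ _ fun x => h_zero n x
  h₁ := SSet.hom_ext fun n => ConcreteCategory.hom_ext _ _ fun x => h_one n x
  -- The relative condition concerns a subcomplex without simplices.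
  rel := by ext _ ⟨⟨_, ⟨⟩⟩, _⟩

/-- The homotopy obtained by composition with a map on the right. -/
def SSet.Homotopy.compRight {X Y Z : SSet.{u}} {f g : X ⟶ Y} (H : SSet.Homotopy f g)
    (k : Y ⟶ Z) : SSet.Homotopy (f ≫ k) (g ≫ k) where
  h := H.h ≫ k
  h₀ := by
    rw [SSet.Homotopy.h₀_assoc]
    rfl
  h₁ := by
    rw [SSet.Homotopy.h₁_assoc]
    rfl
  rel := by ext _ ⟨⟨_, ⟨⟩⟩, _⟩

/-- A simplicial homotopy from the identity of `Y` to a retraction onto the image of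
`i : X ⟶ Y`. -/
structure DeformationRetraction {X Y : SSet.{u}} (i : X ⟶ Y) where
  h (n : SimplexCategoryᵒᵖ) : Y.obj n → (Fin (n.unop.len + 1) → Fin 2) → Y.obj n
  naturality (m n : SimplexCategoryᵒᵖ) (α : m ⟶ n) (y : Y.obj m)
    (s : Fin (m.unop.len + 1) → Fin 2) :
    h n (Y.map α y) (s ∘ α.unop.toOrderHom) = Y.map α (h m y s)
  h_zero (n : SimplexCategoryᵒᵖ) (y : Y.obj n) : h n y (fun _ => 0) = y
  h_one_mem (n : SimplexCategoryᵒᵖ) (y : Y.obj n) : ∃ x : X.obj n, i.app n x = h n y (fun _ => 1)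
  h_one_app (n : SimplexCategoryᵒᵖ) (x : X.obj n) : h n (i.app n x) (fun _ => 1) = i.app n x

namespace DeformationRetraction

variable {X Y : SSet.{u}} {i : X ⟶ Y}

lemma exists_retraction (D : DeformationRetraction i)
    (hi : ∀ n, Function.Injective (i.app n)) :
    ∃ r : Y ⟶ X, i ≫ r = 𝟙 X ∧ Nonempty (SSet.Homotopy (𝟙 Y) (r ≫ i)) := by
  choose r hr using D.h_one_mem
  let ρ : Y ⟶ X :=
    { app := fun n => ↾fun y => r n y
      -- The preimages are chosen simplex by simplex; injectivity of `i` reduces their naturality to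
      -- that of the homotopy at the constant map `1`.
      naturality := fun m n α => ConcreteCategory.hom_ext _ _ fun y => hi n (by
        refine (hr n (Y.map α y)).trans (Eq.trans ?_ (ConcreteCategory.congr_hom (i.naturality α) (r m y)).symm)
        exact (D.naturality m n α y fun _ => 1).trans (congrArg (Y.map α) (hr m y).symm)) }
  refine ⟨ρ, SSet.hom_ext fun n => ConcreteCategory.hom_ext _ _ fun x => hi n ?_,
    ⟨.ofFamily D.h D.naturality D.h_zero fun n y => (hr n y).symm⟩⟩
  exact (hr n (i.app n x)).trans (D.h_one_app n x)

/-- Precomposition with the retraction is a two-sided inverse on homotopy classes: one composite is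
strictly the identity, the other is so up to the homotopy. -/
lemma isWeakEquivalence (D : DeformationRetraction i)
    (hi : ∀ n, Function.Injective (i.app n)) : IsWeakEquivalence i := by
  obtain ⟨r, hir, ⟨H⟩⟩ := D.exists_retraction hi
  intro K _
  refine Function.bijective_iff_has_inverse.mpr ⟨HomotopyClasses.precomp r K, ?_, ?_⟩
  · rintro ⟨g⟩
    refine Eq.symm (Quot.sound ⟨?_⟩)
    exact H.compRight g
  · rintro ⟨g⟩
    change Quot.mk _ (i ≫ r ≫ g) = Quot.mk _ g
    rw [reassoc_of% hir]

end DeformationRetraction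

/-- Deformation retractions onto the images of maps of cyclic sets give one for their disjoint
union. -/
def DeformationRetraction.sigma {ι : Type u} {X Y : ι → CyclicSet.{u}} (f : ∀ c, X c ⟶ Y c)
    (D : ∀ c, DeformationRetraction (f c).toSSetHom) :
    DeformationRetraction (CyclicSet.sigmaMap id f).toSSetHom where
  h n y s := ⟨y.1, (D y.1).h n y.2 s⟩
  naturality m n α y s := congrArg (Sigma.mk y.1) ((D y.1).naturality m n α y.2 s)
  h_zero n y := congrArg (Sigma.mk y.1) ((D y.1).h_zero n y.2)
  h_one_mem n y := by
    obtain ⟨x, hx⟩ := (D y.1).h_one_mem n y.2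
    exact ⟨⟨y.1, x⟩, congrArg (Sigma.mk y.1) hx⟩
  h_one_app n x := congrArg (Sigma.mk x.1) ((D x.1).h_one_app n x.2)

lemma CyclicSet.sigmaMap_id_injective {ι : Type u} {X Y : ι → CyclicSet.{u}}
    (f : ∀ c, X c ⟶ Y c) {n : SimplexCategoryᵒᵖ}
    (hf : ∀ c, Function.Injective ((f c).toSSetHom.app n)) :
    Function.Injective ((CyclicSet.sigmaMap id f).toSSetHom.app n) := by
  rintro ⟨c, x⟩ ⟨c', x'⟩ h
  obtain ⟨rfl, h⟩ := Sigma.mk.inj_iff.mp h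
  exact congrArg (Sigma.mk c) (hf c (eq_of_heq h))

lemma SSet.mono_of_injective {X Y : SSet.{u}} (f : X ⟶ Y)
    (hf : ∀ n, Function.Injective (f.app n)) : Mono f := by
  rw [NatTrans.mono_iff_mono_app]
  exact fun n => (CategoryTheory.mono_iff_injective _).mpr (hf n)

/-! ### Contracting a component of the cyclic nerve to the nerve of a centralizer. -/

section Contraction

variable {G : Type u} [Group G] {p q : ℕ} (k : G → G)

/-- The homotopy from the identity of `N^{cy}(G)` to the map which conjugates the vertices `v` of
the simplices by `k v`. -/
def CyclicNerve.contract (g : Fin (p + 1) → G) (s : Fin (p + 1) → Fin 2) : Fin (p + 1) → G :=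
  twist (fun j => if s j = 1 then k (vertex g j) else 1) g

/-- The twisting elements depend only on the vertices, and simplicial operators merely reindex
vertices. -/
lemma CyclicNerve.cycOp_contract (α : Fin (q + 1) → Fin (p + 1)) (g : Fin (p + 1) → G)
    (s : Fin (p + 1) → Fin 2) : cycOp α (contract k g s) = contract k (cycOp α g) (s ∘ α) := by
  simp only [contract, cycOp_twist, Function.comp_def, vertex_cycOp]

lemma CyclicNerve.cycClass_contract (g : Fin (p + 1) → G) (s : Fin (p + 1) → Fin 2) :
    cycClass (contract k g s) = cycClass g := cycClass_twist _ g

lemma CyclicNerve.contract_zero (g : Fin (p + 1) → G) : contract k g (fun _ => 0) = g := twist_one g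

lemma CyclicNerve.vertex_contract_one (g : Fin (p + 1) → G) (j : Fin (p + 1)) :
    vertex (contract k g (fun _ => 1)) j = (k (vertex g j))⁻¹ * vertex g j * k (vertex g j) :=
  vertex_twist _ g j

lemma CyclicNerve.contract_one_of_vertex {y : G} (hk : k y = 1) (g : Fin (p + 1) → G)
    (hg : ∀ j, vertex g j = y) : contract k g (fun _ => 1) = g := by
  simp only [contract, hg, hk, if_true, twist_one]

variable (c : ConjClasses G) (y : c.carrier)

lemma centralizerNerveMap_injective (n : SimplexCategoryᵒᵖ) :
    Function.Injective ((centralizerNerveMap c y).toSSetHom.app n) := fun _ _ h =>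
  tuple_injective (y : G) (evalAt_injective c y) (congrArg Subtype.val h)

/-- The normalization `k y = 1` makes the end of the contraction the identity on the image of
`BC_c`. -/
lemma exists_conjugator : ∃ k : G → G, (∀ x ∈ c.carrier, (k x)⁻¹ * x * k x = y) ∧ k y = 1 := by
  classical
  choose k hk using fun x : c.carrier => exists_conj x y
  refine ⟨fun x => if hx : x ∈ c.carrier then if x = y then 1 else k ⟨x, hx⟩ else 1,
    fun x hx => ?_, by simp⟩
  by_cases hxy : x = y
  · simp [hxy]
  · simp only [hx, hxy, dif_pos, if_false]
    exact (hk ⟨x, hx⟩).symm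

/-- The contraction of `N^{cy}(G)_c` onto the image of `BC_c`, given by elements conjugating the
elements of `c` to `y`. -/
def centralizerNerveDeformation [IsFreeGroup G]
    (hk : ∀ x ∈ c.carrier, (k x)⁻¹ * x * k x = y) (hy : k y = 1) :
    DeformationRetraction (centralizerNerveMap c y).toSSetHom where
  h n g s := ⟨contract (p := n.unop.len) k g.1 s,
    (cycClass_contract (p := n.unop.len) k g.1 s).trans g.2⟩
  naturality m n α g s := Subtype.ext (cycOp_contract k α.unop.toOrderHom g.1 s).symm
  h_zero n g := Subtype.ext (contract_zero (p := n.unop.len) k g.1)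
  h_one_mem n g := by
    -- At time `1` every vertex has been moved to `y`, so the tuple has entries `1, …, p` in the
    -- centralizer of `y`, which is the image of `C_c`.
    obtain ⟨a, ha⟩ := exists_tuple_eq (p := n.unop.len) (c.evalAt y) (y : G) (range_evalAt c y)
      (contract k g.1 fun _ => 1) fun j => (vertex_contract_one k g.1 j).trans
        (hk _ (mem_carrier_iff_mk_eq.mpr ((mk_vertex (p := n.unop.len) g.1 j).trans g.2)))
    exact ⟨a, Subtype.ext ha⟩
  h_one_app n a := Subtype.ext (contract_one_of_vertex (p := n.unop.len) k hy _
    (vertex_tuple (p := n.unop.len) (c.evalAt y) y (c.evalAt_mul_comm y) a))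

lemma nonempty_deformationRetraction [IsFreeGroup G] :
    Nonempty (DeformationRetraction (centralizerNerveMap c y).toSSetHom) := by
  obtain ⟨k, hk, hy⟩ := exists_conjugator c y
  exact ⟨centralizerNerveDeformation k c y hk hy⟩

end Contraction

/-! ### Naturality up to canonical homotopy. -/

/-- The standard homotopies given by conjugation, for a map `φ` to `N^{cy}(G)` and a locally
constant function `h` with values in `G`. -/
def SSet.Homotopy.ofConjugation {X : SSet.{u}} {G : Type u} [Group G]
    {φ ψ : X ⟶ (cyclicNerve G).toSSet} (h : ∀ n, X.obj n → G)
    (hnat : ∀ (m n : SimplexCategoryᵒᵖ) (α : m ⟶ n) (x : X.obj m), h n (X.map α x) = h m x)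
    (hψ : ∀ n x, twist (p := n.unop.len) (fun _ => h n x) (φ.app n x) = ψ.app n x) :
    SSet.Homotopy φ ψ :=
  .ofFamily (fun n x s => conjugationHomotopy (p := n.unop.len) (h n x) (φ.app n x) s)
    (fun m n α x s =>
      have e : φ.app n (X.map α x) = cycOp α.unop.toOrderHom (φ.app m x) :=
        ConcreteCategory.congr_hom (φ.naturality α) x
      (congrArg₂ (fun k g => conjugationHomotopy (p := n.unop.len) k g
        (s ∘ α.unop.toOrderHom)) (hnat m n α x) e).trans
        (cycOp_conjugationHomotopy α.unop.toOrderHom (h m x) (φ.app m x) s).symm)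
    (fun n _ => twist_one (G := G) (p := n.unop.len) _) hψ

section Naturality

variable {G H : FreeGrp.{u}} (f : G ⟶ H) (b : ∀ c : ConjClasses G.obj, c.carrier)
  (b' : ∀ c : ConjClasses H.obj, c.carrier)

lemma exists_isConjugating : ∃ h, IsConjugating f b b' h := by
  classical
  choose k hk using fun c : ConjClasses G.obj =>
    exists_conj (mapCarrier f.hom.hom (b c)) (b' (c.map f.hom.hom))
  -- At the trivial class both chosen elements are `1`, so the prescribed value `1` is a conjugator
  -- there.
  refine ⟨fun c => if c = 1 then 1 else k c, if_pos rfl, fun c => ?_⟩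
  by_cases hc : c = 1
  · subst hc
    have h1 : ((b 1 : (1 : ConjClasses G.obj).carrier) : G.obj) = 1 := (coe_eq_one_iff _ _).mpr rfl
    have h2 : ((b' ((1 : ConjClasses G.obj).map f.hom.hom) : _) : H.obj) = 1 :=
      (coe_eq_one_iff _ _).mpr
        ((coe_eq_one_iff _ (mapCarrier f.hom.hom (b 1))).mp (by simp [mapCarrier, h1]))
    simp [h1, h2]
  · simp only [if_neg hc]
    exact (hk c).symm

variable {f b b'}

/-- If `f(c)` is nontrivial, this is the compatibility of families in `C_{f(c)}` with conjugation.
If `f(c)` is trivial, that compatibility is absent, and either `h c = 1` or both sides are trivial.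
-/
lemma IsConjugating.evalAt_canonicalMap {h : ConjClasses G.obj → H.obj}
    (hh : IsConjugating f b b' h) (c : ConjClasses G.obj) (a : c.canonicalCentralizer) :
    (c.map f.hom.hom).evalAt (b' _) (c.canonicalMap f.hom.hom a) =
      (h c)⁻¹ * f.hom.hom (c.evalAt (b c) a) * h c := by
  rw [← ConjClasses.evalAt_canonicalMap]
  by_cases hfc : c.map f.hom.hom = 1
  · have hb : b' (c.map f.hom.hom) = mapCarrier f.hom.hom (b c) := Subtype.ext (by
      rw [(coe_eq_one_iff _ _).mpr hfc, (coe_eq_one_iff _ _).mpr hfc])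
    rw [hb]
    by_cases hc : c = 1
    -- The components here are arbitrary elements of the group, so the normalization `h 1 = 1` is
    -- essential.
    · subst hc
      rw [hh.1]
      simp
    -- A nontrivial `b c` killed by `f` is a power of a generator of its centralizer. The target is
    -- torsion-free, so `f` kills the whole centralizer and `h c` plays no role.
    · rw [ConjClasses.evalAt_canonicalMap, FreeGroupFacts.map_eq_one f.hom.hom
        (fun h => hc ((coe_eq_one_iff c (b c)).mp h)) (c.evalAt_mul_comm (b c) a)
        ((coe_eq_one_iff _ (mapCarrier f.hom.hom (b c))).mpr hfc)]
      simp
  · exact evalAt_conj hfc _ (hh.2 c).symm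

/-- This identifies the end of the standard homotopy with the other composite of the square. -/
lemma IsConjugating.twist_tuple {h : ConjClasses G.obj → H.obj}
    (hh : IsConjugating f b b' h) (c : ConjClasses G.obj) {p : ℕ}
    (a : Fin p → c.canonicalCentralizer) :
    twist (fun _ => h c) (f.hom.hom ∘ tuple (c.evalAt (b c)) (b c) a) =
      tuple ((c.map f.hom.hom).evalAt (b' _)) (b' (c.map f.hom.hom)) (c.canonicalMap f.hom.hom ∘ a) :=
  ext_base_loop
    (by
      ext j
      rw [base_twist, base_comp, base_tuple, base_tuple, partialProd_comp,
        hh.evalAt_canonicalMap])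
    (by rw [loop_twist, loop_comp, loop_tuple, loop_tuple, hh.2])

variable (f b b') in
lemma commutesUpToCanonicalHomotopy : CommutesUpToCanonicalHomotopy f b b' := by
  refine ⟨exists_isConjugating f b b', ?_⟩
  intro h hh top bottom
  -- The conjugating element depends only on the summand, which simplicial operators preserve.
  exact ⟨.ofConjugation (fun _ x => h x.1) (fun _ _ _ _ => rfl)
    fun n x => hh.twist_tuple x.1 (p := n.unop.len) x.2, fun _ _ _ => rfl⟩

end Naturality

/-! ### Assembly of the theorem. -/

theorem mainTheorem7 (Γ : SimplicialObject FreeGrp.{u}) :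
    (∀ (n : SimplexCategoryᵒᵖ) (c : ConjClasses (Γ.obj n).obj),
      (∀ y : c.carrier, Function.Injective (c.evalAt y) ∧
        (c.evalAt y).range = Subgroup.centralizer {(y : (Γ.obj n).obj)}) ∧
      (c ≠ 1 → ∃! r : c.canonicalCentralizer, ∀ y : c.carrier,
        Subgroup.zpowers (c.evalAt y r) = Subgroup.centralizer {(y : (Γ.obj n).obj)} ∧
        ∃ k : ℕ, 0 < k ∧ c.evalAt y r ^ k = y)) ∧
    ∀ b : ∀ (n : SimplexCategoryᵒᵖ) (c : ConjClasses (Γ.obj n).obj), c.carrier,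
      (∀ (n : SimplexCategoryᵒᵖ) (c : ConjClasses (Γ.obj n).obj),
        Mono (centralizerNerveMap c (b n c)).toSSetHom ∧
        IsWeakEquivalence (centralizerNerveMap c (b n c)).toSSetHom) ∧
      (∀ n : SimplexCategoryᵒᵖ, Mono (centralizerNervesMap (b n)).toSSetHom ∧
        IsWeakEquivalence (centralizerNervesMap (b n)).toSSetHom) ∧
      (∀ (m n : SimplexCategoryᵒᵖ) (α : m ⟶ n),
        CommutesUpToCanonicalHomotopy (Γ.map α) (b m) (b n)) ∧
      (∀ (Γ' : SimplicialObject FreeGrp.{u}) (f : Γ ⟶ Γ')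
        (b' : ∀ (n : SimplexCategoryᵒᵖ) (c : ConjClasses (Γ'.obj n).obj), c.carrier)
        (n : SimplexCategoryᵒᵖ), CommutesUpToCanonicalHomotopy (f.app n) (b n) (b' n)) := by
  refine ⟨fun n c => ⟨fun y => ⟨evalAt_injective c y, range_evalAt c y⟩, existsUnique_root⟩,
    fun b => ⟨fun n c => ?_, fun n => ?_, fun m n α => commutesUpToCanonicalHomotopy _ _ _,
      fun Γ' f b' n => commutesUpToCanonicalHomotopy _ _ _⟩⟩
  · obtain ⟨D⟩ := nonempty_deformationRetraction c (b n c)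
    have hi := centralizerNerveMap_injective c (b n c)
    exact ⟨SSet.mono_of_injective _ hi, D.isWeakEquivalence hi⟩
  -- The retractions of the summands are combined into one of the disjoint union, so no separate
  -- argument about `[-, K]` of a coproduct is needed.
  · have D := fun c => (nonempty_deformationRetraction c (b n c)).some
    have hi := fun k => CyclicSet.sigmaMap_id_injective (fun c => centralizerNerveMap c (b n c))
      fun c => centralizerNerveMap_injective c (b n c) k
    exact ⟨SSet.mono_of_injective _ hi, (DeformationRetraction.sigma _ D).isWeakEquivalence hi⟩
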